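/- For $\alpha\in(0,1)$ and $\lambda>0$ let $X_{\alpha,\lambda}$ denote a Mittag-Leffler random variable of index $\alpha$ and scale $\lambda$, i.e. $X_{\alpha,\lambda}\ge 0$ with $$P\{X_{\alpha,\lambda}\le t\}=1-E_{\alpha,1}(-(\lambda t)^{\alpha})\quad(t\ge 0),\qquad E_{\alpha,1}(z)=\sum_{\ell\ge 0}\frac{z^{\ell}}{\Gamma(1+\alpha\ell)} .$$ Let $\alpha,\beta\in(0,1)$ and $\lambda,\mu>0$, and let $(X^{(n)})_{n\ge1}$, $(Y^{(n)})_{n\ge1}$ be two independent i.i.d. sequences with $X^{(n)}\sim X_{\alpha,\lambda}$ and $Y^{(n)}\sim X_{\beta,\mu}$. The renewal queue has inter-event times $X^{(n)}\wedge Y^{(n)}$. Its $n$-th event is an arrival if $X^{(n)}<Y^{(n)}$, and otherwise a departure attempt, which removes one customer if the queue is non-empty and has no effect if it is empty. Let $Q_n$ be the queue length after $n$ events (the embedded queue, a Markov chain on $\{0,1,2,\dots\}$, started from any state $Q_0=i_0$), let $R_t=\max\{n:\sum_{k\le n}X^{(k)}\wedge Y^{(k)}\le t\}$ be the number of events up to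 time $t$, and let $L_t=Q_{R_t}$ be the queue length at time $t$. Then for all $\alpha,\beta\in(0,1)$ there is a critical value $\rho^*_{\alpha,\beta}\in(0,\infty)$, depending only on $\alpha$ and $\beta$, such that for all $\lambda,\mu>0$: 1. the embedded queue $(Q_n)$ is transient if and only if $\lambda/\mu>\rho^*_{\alpha,\beta}$; 2. if $\lambda/\mu<\rho^*_{\alpha,\beta}$, then with $p=P\{X_{\alpha,\lambda}<X_{\beta,\mu}\}$ (the two variables being independent) the weights $$\pi_j=\frac{1-2p}{1-p}\Big(\frac{p}{1-p}\Big)^{j},\qquad j=0,1,2,\dots,$$ form a probability distribution, which is the unique invariant distribution of $(Q_n)$, and for every initial state and every $j$ one has $\lim_{n\to\infty}P\{Q_n=j\}=\pi_j$ and $\lim_{t\to\infty}P\{L_t=j\}=\pi_j$; 3. if $\lambda/\mu=\rho^*_{\alpha,\beta}$, then the embedded queue $(Q_n)$ is null recurrent. -/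

import Mathlib

open MeasureTheory ProbabilityTheory Filter Topology
open scoped ENNReal

noncomputable section

namespace RenewalQueue

/-- The two-parameter Mittag-Leffler function `E_{a,b}(z) = ∑ z ^ l / Γ(b + a l)`
(the series converges absolutely for every real `z` when `a, b > 0`). -/
def mittagLeffler (a b z : ℝ) : ℝ :=
  ∑' l : ℕ, z ^ l / Real.Gamma (b + a * l)

/-- The cumulative distribution function of the Mittag-Leffler law of index `a` and
scale `r`: it is `1 - E_{a,1}(-(r t)^a)` for `t ≥ 0`, and `0` for `t < 0`. -/
def mittagLefflerCDF (a r t : ℝ) : ℝ :=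
  if t < 0 then 0 else 1 - mittagLeffler a 1 (-(r * t) ^ a)

variable {Ω : Type*}

/-- `X` and `Y` are two independent i.i.d. sequences of Mittag-Leffler random variables, the
first of index `a` and scale `lam`, the second of index `b` and scale `mu`. -/
structure IsMittagLefflerClocks [MeasurableSpace Ω] (P : Measure Ω) (a b lam mu : ℝ)
    (X Y : ℕ → Ω → ℝ) : Prop where
  measurable_left : ∀ n, Measurable (X n)
  measurable_right : ∀ n, Measurable (Y n)
  cdf_left : ∀ n t, P.real {ω | X n ω ≤ t} = mittagLefflerCDF a lam t
  cdf_right : ∀ n t, P.real {ω | Y n ω ≤ t} = mittagLefflerCDF b mu t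
  indep : iIndepFun (Sum.elim X Y : ℕ ⊕ ℕ → Ω → ℝ) P

/-- The embedded queue length after `n` events, started from `i` customers. The event number
`n + 1` is an arrival if the clock `X n` rings strictly before `Y n`, and a departure attempt
otherwise. A departure attempt removes one customer if there is one and has no effect on an
empty queue (the subtraction of natural numbers is truncated). -/
def embeddedQueue (X Y : ℕ → Ω → ℝ) (i : ℕ) : ℕ → Ω → ℕ
  | 0, _ => i
  | n + 1, ω =>
    if X n ω < Y n ω then embeddedQueue X Y i n ω + 1 else embeddedQueue X Y i n ω - 1

/-- The time of the `n`-th event: the sum of the first `n` inter-event times `min X Y`. -/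
def eventTime (X Y : ℕ → Ω → ℝ) (n : ℕ) (ω : Ω) : ℝ :=
  ∑ k ∈ Finset.range n, min (X k ω) (Y k ω)

/-- The renewal counting process `R_t`: the number of events up to time `t`. -/
def eventCount (X Y : ℕ → Ω → ℝ) (t : ℝ) (ω : Ω) : ℕ :=
  sSup {n : ℕ | eventTime X Y n ω ≤ t}

/-- The queue length at time `t`, which is the embedded queue length after `R_t` events. -/
def queueLength (X Y : ℕ → Ω → ℝ) (i : ℕ) (t : ℝ) (ω : Ω) : ℕ :=
  embeddedQueue X Y i (eventCount X Y t ω) ω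

/-! In the next definitions `Q i n` is the position at time `n` of a Markov chain on `ℕ` that
is started from the state `i`. -/

/-- Every state `i` is transient: started from `i`, the chain almost surely visits `i` only
finitely often. -/
def IsTransient [MeasurableSpace Ω] (P : Measure Ω) (Q : ℕ → ℕ → Ω → ℕ) : Prop :=
  ∀ i, P {ω | ∃ᶠ n in atTop, Q i n ω = i} = 0

/-- Every state `i` is recurrent: started from `i`, the chain almost surely visits `i`
infinitely often. -/
def IsRecurrent [MeasurableSpace Ω] (P : Measure Ω) (Q : ℕ → ℕ → Ω → ℕ) : Prop :=
  ∀ i, ∀ᵐ ω ∂P, ∃ᶠ n in atTop, Q i n ω = i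

/-- The first return time to the initial state `i`, equal to `∞` if there is no return. -/
def returnTime (Q : ℕ → ℕ → Ω → ℕ) (i : ℕ) (ω : Ω) : ℝ≥0∞ :=
  ⨅ n : ℕ, ⨅ _ : 1 ≤ n ∧ Q i n ω = i, (n : ℝ≥0∞)

/-- Every state is recurrent with infinite expected return time. -/
def IsNullRecurrent [MeasurableSpace Ω] (P : Measure Ω) (Q : ℕ → ℕ → Ω → ℕ) : Prop :=
  IsRecurrent P Q ∧ ∀ i, ∫⁻ ω, returnTime Q i ω ∂P = ∞

/-- The probability distribution `ν` is invariant under the transition probabilities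
`P (Q i 1 = j)` from `i` to `j`. -/
def IsInvariant [MeasurableSpace Ω] (P : Measure Ω) (Q : ℕ → ℕ → Ω → ℕ) (ν : PMF ℕ) : Prop :=
  ∀ j, ∑' i, ν i * P {ω | Q i 1 ω = j} = ν j

/-- The geometric weights `(1 - 2p)/(1 - p) * (p/(1 - p)) ^ j`. -/
def equilibriumWeight (p : ℝ) (j : ℕ) : ℝ :=
  (1 - 2 * p) / (1 - p) * (p / (1 - p)) ^ j

end RenewalQueue

end

open RenewalQueue

/-!
The probability `p = P (X < Y)` depends on the scales only through `λ / μ`, and it increases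
continuously and strictly from `0` to `1` with that ratio, so it takes the value `1 / 2` exactly
once. All of this rests on the monotonicity of the tail `t ↦ E_α (-t ^ α)`. It holds because the
tail is the scaling limit of the coefficients of `(1 - X)⁻¹ / (1 + δ (1 - X) ^ (-α))`, and for these
it is a sign argument with formal power series; the tail is analytic on `t > 0`, so it is even
strictly decreasing.

The embedded queue is a simple random walk that is pushed up at `0`. For `p > 1 / 2` the walk tends
to `∞` by the strong law of large numbers. For `p < 1 / 2`, reversing the order of the first `n`
events turns the queue length into the maximum of the walk up to time `n`, which increases to the
finite overall maximum. For `p = 1 / 2` the walk is a martingale with bounded steps, so it is almost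
surely unbounded in both directions and the queue is recurrent. The first excursion of the queue,
stopped when it ends, then has constant mean height `1 / 2` although it tends to `0`, which forces
the return time to have infinite mean.
-/

namespace RenewalQueue

open Ring (multichoose)
open Finset.HasAntidiagonal (antidiagonal)

section Multichoose

variable {R : Type*} [CommRing R] [BinomialRing R]

lemma factorial_mul_multichoose (s : R) (n : ℕ) :
    (n.factorial : R) * multichoose s n = ∏ j ∈ Finset.range n, (s + j) := by
  rw [← nsmul_eq_mul, Ring.factorial_nsmul_multichoose_eq_ascPochhammer,
    Polynomial.ascPochhammer_smeval_eq_eval]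
  induction n with
  | zero => simp
  | succ n ih => rw [ascPochhammer_succ_eval, ih, Finset.prod_range_succ]

/-- The formal power series `(1 - X) ^ (-s)`. -/
noncomputable def multichooseSeries (s : R) : PowerSeries R :=
  PowerSeries.mk (multichoose s)

@[simp]
lemma coeff_multichooseSeries (s : R) (n : ℕ) :
    PowerSeries.coeff n (multichooseSeries s) = multichoose s n :=
  PowerSeries.coeff_mk _ _

@[simp]
lemma constantCoeff_multichooseSeries (s : R) :
    PowerSeries.constantCoeff (multichooseSeries s) = 1 := by
  rw [← PowerSeries.coeff_zero_eq_constantCoeff_apply, coeff_multichooseSeries,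
    Ring.multichoose_zero_right]

lemma multichooseSeries_eq_rescale (s : R) :
    multichooseSeries s = PowerSeries.rescale (-1) (PowerSeries.binomialSeries R (-s)) := by
  ext n
  rw [coeff_multichooseSeries, PowerSeries.coeff_rescale, PowerSeries.binomialSeries_coeff,
    Ring.choose_neg, ← Ring.multichoose_eq]
  simp [Units.smul_def, zsmul_eq_mul, ← mul_assoc, ← mul_pow]

lemma multichooseSeries_add (s t : R) :
    multichooseSeries (s + t) = multichooseSeries s * multichooseSeries t := by
  simp only [multichooseSeries_eq_rescale, neg_add, PowerSeries.binomialSeries_add, map_mul]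

lemma multichooseSeries_mul_neg (s : R) : multichooseSeries s * multichooseSeries (-s) = 1 := by
  rw [← multichooseSeries_add, add_neg_cancel, multichooseSeries_eq_rescale, neg_zero,
    PowerSeries.binomialSeries_zero, map_one]

lemma multichooseSeries_neg_one : multichooseSeries (-1 : R) = 1 - PowerSeries.X := by
  have h := PowerSeries.binomialSeries_nat (R := R) (A := R) 1
  rw [multichooseSeries_eq_rescale, neg_neg, ← Nat.cast_one, h]
  simp [sub_eq_add_neg]

lemma sum_antidiagonal_multichoose_mul (s t : R) (n : ℕ) :
    ∑ ij ∈ antidiagonal n, multichoose s ij.1 * multichoose t ij.2 = multichoose (s + t) n := by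
  simp only [← coeff_multichooseSeries, multichooseSeries_add, PowerSeries.coeff_mul]

lemma sum_range_multichoose (s : R) (n : ℕ) :
    ∑ k ∈ Finset.range (n + 1), multichoose s k = multichoose (s + 1) n := by
  rw [← sum_antidiagonal_multichoose_mul, Finset.Nat.sum_antidiagonal_eq_sum_range_succ_mk]
  simp

end Multichoose

section RealMultichoose

lemma multichoose_nonneg {s : ℝ} (hs : 0 ≤ s) (n : ℕ) : 0 ≤ multichoose s n := by
  have hn : (0 : ℝ) < n.factorial := by positivity
  rw [← mul_nonneg_iff_of_pos_left hn, factorial_mul_multichoose]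
  positivity

lemma multichoose_neg_nonpos {a : ℝ} (ha : 0 ≤ a) (ha1 : a ≤ 1) {n : ℕ} (hn : n ≠ 0) :
    multichoose (-a) n ≤ 0 := by
  obtain ⟨n, rfl⟩ := Nat.exists_eq_succ_of_ne_zero hn
  have hfact : (0 : ℝ) < (n + 1).factorial := by positivity
  refine (mul_nonpos_iff_pos_imp_nonpos.1 ?_).1 hfact
  rw [factorial_mul_multichoose, Finset.prod_range_succ']
  refine mul_nonpos_of_nonneg_of_nonpos (Finset.prod_nonneg fun j _ => ?_) (by simpa using ha)
  push_cast
  linarith [j.cast_nonneg (α := ℝ)]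

lemma hasSum_multichoose_mul_pow (s : ℝ) {z : ℝ} (hz : |z| < 1) :
    HasSum (fun n => multichoose s n * z ^ n) (1 / (1 - z) ^ s) := by
  have h := (Real.one_div_one_sub_rpow_hasFPowerSeriesOnBall_zero s).hasSum (y := z) (by
    simpa [enorm_eq_nnnorm, ← NNReal.coe_lt_coe] using hz)
  simpa [FormalMultilinearSeries.ofScalars_apply_eq, ← Ring.multichoose_eq, mul_comm] using h

lemma multichoose_add_one_mul_pow_le {s : ℝ} (hs : 0 ≤ s) {z : ℝ} (hz : 0 ≤ z) (hz1 : z < 1)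
    (n : ℕ) : multichoose (s + 1) n * z ^ n ≤ 1 / (1 - z) ^ s := by
  have hsum := hasSum_multichoose_mul_pow s (abs_lt.2 ⟨by linarith, hz1⟩)
  have hnonneg := multichoose_nonneg hs
  rw [← sum_range_multichoose, Finset.sum_mul]
  calc ∑ k ∈ Finset.range (n + 1), multichoose s k * z ^ n
    _ ≤ ∑ k ∈ Finset.range (n + 1), multichoose s k * z ^ k :=
      Finset.sum_le_sum fun k hk => mul_le_mul_of_nonneg_left
        (pow_le_pow_of_le_one hz hz1.le (Finset.mem_range_succ_iff.1 hk)) (hnonneg k)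
    _ ≤ 1 / (1 - z) ^ s := hsum.tsum_eq ▸ hsum.summable.sum_le_tsum _
      fun k _ => mul_nonneg (hnonneg k) (pow_nonneg hz k)

lemma one_le_exp_mul_div_add_pow {R : ℝ} (hR : 0 ≤ R) (n : ℕ) :
    1 ≤ Real.exp R * (n / (n + R)) ^ n := by
  rcases n.eq_zero_or_pos with rfl | hn
  · simpa using hR
  have hn0 : (0 : ℝ) < n := by exact_mod_cast hn
  have hpow : (1 + R / n) ^ n ≤ Real.exp R := by
    calc (1 + R / n) ^ n
      _ ≤ Real.exp (R / n) ^ n := by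
        gcongr
        linarith [Real.add_one_le_exp (R / n)]
      _ = Real.exp R := by rw [← Real.exp_nat_mul, mul_div_cancel₀ _ hn0.ne']
  calc (1 : ℝ)
    _ = (1 + R / n) ^ n * (n / (n + R)) ^ n := by
      rw [← mul_pow, show (1 + R / n) * (n / (n + R)) = 1 by field_simp, one_pow]
    _ ≤ Real.exp R * (n / (n + R)) ^ n := by gcongr

lemma multichoose_add_one_le_exp_mul_rpow {s : ℝ} (hs : 0 ≤ s) {R : ℝ} (hR : 0 < R) (n : ℕ) :
    multichoose (s + 1) n ≤ Real.exp R * ((n + R) / R) ^ s := by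
  -- `z = n / (n + R)` with `R` in place of `s` is the saddle point of `(1 - z) ^ (-s) * z ^ (-n)`.
  have hn : 0 < n + R := by positivity
  have hz : 1 - n / (n + R) = R / (n + R) := by field_simp; ring
  have h := multichoose_add_one_mul_pow_le hs (z := n / (n + R)) (by positivity)
    (by rw [div_lt_one hn]; linarith) n
  rw [hz, one_div, ← Real.inv_rpow (by positivity), inv_div] at h
  calc multichoose (s + 1) n
    _ ≤ multichoose (s + 1) n * (Real.exp R * (n / (n + R)) ^ n) :=
      le_mul_of_one_le_right (multichoose_nonneg (by linarith) n)
        (one_le_exp_mul_div_add_pow hR.le n)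
    _ = Real.exp R * (multichoose (s + 1) n * (n / (n + R)) ^ n) := by ring
    _ ≤ Real.exp R * ((n + R) / R) ^ s := by gcongr

lemma tendsto_multichoose_add_one_div_rpow {s : ℝ} (hs : 0 ≤ s) :
    Tendsto (fun n : ℕ => multichoose (s + 1) n / (n : ℝ) ^ s) atTop
      (𝓝 (Real.Gamma (1 + s))⁻¹) := by
  rcases hs.eq_or_lt with rfl | hs
  · simp
  have hG : Real.Gamma (1 + s) = s * Real.Gamma s := by rw [add_comm, Real.Gamma_add_one hs.ne']
  have h := ((Real.GammaSeq_tendsto_Gamma s).const_mul s).inv₀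
    (by rw [← hG]; exact (Real.Gamma_pos_of_pos (by linarith)).ne')
  rw [← hG] at h
  refine h.congr' ?_
  filter_upwards [eventually_gt_atTop 0] with n hn
  have hprod : ∏ j ∈ Finset.range (n + 1), (s + j) =
      s * (n.factorial * multichoose (s + 1) n) := by
    rw [factorial_mul_multichoose, Finset.prod_range_succ', mul_comm]
    simp [add_assoc, add_comm (1 : ℝ)]
  have : (n : ℝ) ^ s ≠ 0 := (Real.rpow_pos_of_pos (by exact_mod_cast hn) s).ne'
  rw [Real.GammaSeq, hprod]
  field_simp

lemma tendsto_nat_floor_mul_natCast_atTop {t : ℝ} (ht : 0 < t) :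
    Tendsto (fun N : ℕ => ⌊t * N⌋₊) atTop atTop :=
  tendsto_nat_floor_atTop.comp (tendsto_natCast_atTop_atTop.const_mul_atTop ht)

lemma tendsto_inv_rpow_mul_multichoose_floor {s : ℝ} (hs : 0 ≤ s) {t : ℝ} (ht : 0 < t) :
    Tendsto (fun N : ℕ => ((N : ℝ) ^ s)⁻¹ * multichoose (s + 1) ⌊t * N⌋₊) atTop
      (𝓝 (t ^ s / Real.Gamma (1 + s))) := by
  have hfloor : Tendsto (fun N : ℕ => ((⌊t * N⌋₊ : ℝ) / N) ^ s) atTop (𝓝 (t ^ s)) :=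
    ((tendsto_nat_floor_mul_div_atTop ht.le).comp tendsto_natCast_atTop_atTop).rpow_const
      (Or.inl ht.ne')
  have htop := tendsto_nat_floor_mul_natCast_atTop ht
  rw [div_eq_mul_inv]
  refine (hfloor.mul ((tendsto_multichoose_add_one_div_rpow hs).comp htop)).congr' ?_
  filter_upwards [htop.eventually_gt_atTop 0] with N hN
  have : (⌊t * N⌋₊ : ℝ) ^ s ≠ 0 := (Real.rpow_pos_of_pos (by exact_mod_cast hN) s).ne'
  simp only [Function.comp_apply]
  rw [Real.div_rpow (by positivity) (by positivity)]
  field_simp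

end RealMultichoose

section DiscreteTail

lemma coeff_nonneg_of_coeff_mul_nonneg {R : Type*} [Ring R] [LinearOrder R] [IsStrictOrderedRing R]
    {f g : PowerSeries R} (hg0 : 0 < PowerSeries.coeff 0 g)
    (hg : ∀ n ≠ 0, PowerSeries.coeff n g ≤ 0) (hfg : ∀ n, 0 ≤ PowerSeries.coeff n (f * g))
    (n : ℕ) : 0 ≤ PowerSeries.coeff n f := by
  induction n using Nat.strong_induction_on with
  | _ n ih =>
    have hn := hfg n
    rw [PowerSeries.coeff_mul, Finset.Nat.sum_antidiagonal_eq_sum_range_succ_mk,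
      Finset.sum_range_succ, Nat.sub_self] at hn
    have hsum : ∑ k ∈ Finset.range n, PowerSeries.coeff k f * PowerSeries.coeff (n - k) g ≤ 0 :=
      Finset.sum_nonpos fun k hk => mul_nonpos_of_nonneg_of_nonpos (ih k (Finset.mem_range.1 hk))
        (hg _ (Nat.sub_ne_zero_of_lt (Finset.mem_range.1 hk)))
    exact nonneg_of_mul_nonneg_left (hn.trans (add_le_of_nonpos_left hsum)) hg0

/-- The power series `(1 - X)⁻¹ / (1 + δ (1 - X) ^ (-a))`. Its coefficients are the tail
probabilities of a discrete Mittag-Leffler law; for `δ = N ^ (-a)`, that law divided by `N`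
approximates the Mittag-Leffler law of index `a`. -/
noncomputable def discreteTail (a δ : ℝ) : PowerSeries ℝ :=
  multichooseSeries 1 * (1 + PowerSeries.C δ * multichooseSeries a)⁻¹

variable {a δ : ℝ}

lemma constantCoeff_one_add_C_mul_multichooseSeries :
    PowerSeries.constantCoeff (1 + PowerSeries.C δ * multichooseSeries a) = 1 + δ := by
  simp

lemma discreteTail_mul_one_add (hδ : 0 ≤ δ) :
    discreteTail a δ * (1 + PowerSeries.C δ * multichooseSeries a) = multichooseSeries 1 := by
  have h : PowerSeries.constantCoeff (1 + PowerSeries.C δ * multichooseSeries a) ≠ 0 := by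
    rw [constantCoeff_one_add_C_mul_multichooseSeries]
    positivity
  rw [discreteTail, mul_assoc, PowerSeries.inv_mul_cancel _ h, mul_one]

lemma eq_discreteTail_of_mul_one_add (hδ : 0 ≤ δ) {f : PowerSeries ℝ}
    (hf : f * (1 + PowerSeries.C δ * multichooseSeries a) = multichooseSeries 1) :
    f = discreteTail a δ := by
  have h : 1 + PowerSeries.C δ * multichooseSeries a ≠ 0 := fun h0 => by
    have := constantCoeff_one_add_C_mul_multichooseSeries (a := a) (δ := δ)
    rw [h0, map_zero] at this
    linarith
  exact mul_right_cancel₀ h (hf.trans (discreteTail_mul_one_add hδ).symm)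

lemma discreteTail_mul_add_C (hδ : 0 ≤ δ) :
    discreteTail a δ * (multichooseSeries (-a) + PowerSeries.C δ) = multichooseSeries (1 - a) := by
  rw [sub_eq_add_neg, multichooseSeries_add, ← discreteTail_mul_one_add hδ (a := a)]
  linear_combination -discreteTail a δ * PowerSeries.C δ * multichooseSeries_mul_neg a

lemma coeff_nonneg_of_coeff_mul_add_C_nonneg (ha : 0 ≤ a) (ha1 : a ≤ 1) (hδ : 0 ≤ δ)
    {f : PowerSeries ℝ}
    (hf : ∀ n, 0 ≤ PowerSeries.coeff n (f * (multichooseSeries (-a) + PowerSeries.C δ)))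
    (n : ℕ) : 0 ≤ PowerSeries.coeff n f := by
  refine coeff_nonneg_of_coeff_mul_nonneg ?_ (fun k hk => ?_) hf n
  · simp only [map_add, coeff_multichooseSeries, Ring.multichoose_zero_right,
      PowerSeries.coeff_zero_C]
    positivity
  · simpa [PowerSeries.coeff_C, hk] using multichoose_neg_nonpos ha ha1 hk

lemma coeff_discreteTail_nonneg (ha : 0 ≤ a) (ha1 : a ≤ 1) (hδ : 0 ≤ δ) (n : ℕ) :
    0 ≤ PowerSeries.coeff n (discreteTail a δ) := by
  refine coeff_nonneg_of_coeff_mul_add_C_nonneg ha ha1 hδ (fun k => ?_) n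
  rw [discreteTail_mul_add_C hδ, coeff_multichooseSeries]
  exact multichoose_nonneg (by linarith) k

lemma antitone_coeff_discreteTail (ha : 0 ≤ a) (ha1 : a ≤ 1) (hδ : 0 ≤ δ) :
    Antitone fun n => PowerSeries.coeff n (discreteTail a δ) := by
  have hmul : (1 - discreteTail a δ * (1 - PowerSeries.X)) *
      (multichooseSeries (-a) + PowerSeries.C δ) = PowerSeries.C δ := by
    have h := discreteTail_mul_add_C hδ (a := a)
    rw [sub_eq_add_neg, multichooseSeries_add] at h
    have h1 := multichooseSeries_mul_neg (1 : ℝ)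
    rw [multichooseSeries_neg_one] at h1
    linear_combination -(1 - PowerSeries.X) * h - multichooseSeries (-a) * h1
  have hnonneg := coeff_nonneg_of_coeff_mul_add_C_nonneg ha ha1 hδ (fun n => by
    rw [hmul, PowerSeries.coeff_C]
    split_ifs <;> positivity)
  refine antitone_nat_of_succ_le fun n => ?_
  have := hnonneg (n + 1)
  simp only [mul_sub, mul_one, map_sub, PowerSeries.coeff_one, Nat.succ_ne_zero, if_false,
    PowerSeries.coeff_succ_mul_X] at this
  linarith

lemma coeff_discreteTail_mul_le_one (ha : 0 ≤ a) (ha1 : a ≤ 1) (hδ : 0 ≤ δ) (n : ℕ) :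
    PowerSeries.coeff n (discreteTail a δ) * (1 + δ * multichoose (a + 1) n) ≤ 1 := by
  have hcoeff := congrArg (PowerSeries.coeff n) (discreteTail_mul_one_add hδ (a := a))
  rw [mul_add, mul_one, mul_left_comm, map_add, PowerSeries.coeff_C_mul, PowerSeries.coeff_mul,
    coeff_multichooseSeries, Ring.multichoose_one] at hcoeff
  have hsum : PowerSeries.coeff n (discreteTail a δ) * multichoose (a + 1) n ≤
      ∑ ij ∈ antidiagonal n, PowerSeries.coeff ij.1 (discreteTail a δ) *
        PowerSeries.coeff ij.2 (multichooseSeries a) := by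
    rw [add_comm a, ← sum_antidiagonal_multichoose_mul, Finset.mul_sum]
    refine Finset.sum_le_sum fun ij hij => ?_
    rw [Ring.multichoose_one, one_mul, coeff_multichooseSeries]
    exact mul_le_mul_of_nonneg_right
      (antitone_coeff_discreteTail ha ha1 hδ (Finset.HasAntidiagonal.antidiagonal.fst_le hij))
      (multichoose_nonneg ha _)
  linarith [mul_le_mul_of_nonneg_left hsum hδ]

lemma coeff_discreteTail_eq_tsum (hδ : 0 ≤ δ) (n : ℕ)
    (hs : ∀ k, Summable fun l : ℕ => (-δ) ^ l * multichoose (a * l + 1) k) :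
    PowerSeries.coeff n (discreteTail a δ) =
      ∑' l : ℕ, (-δ) ^ l * multichoose (a * l + 1) n := by
  -- Expand `1 / (1 + δ (1 - X) ^ (-a))` as a geometric series.
  suffices PowerSeries.mk (fun k => ∑' l : ℕ, (-δ) ^ l * multichoose (a * l + 1) k) =
      discreteTail a δ by rw [← this, PowerSeries.coeff_mk]
  refine eq_discreteTail_of_mul_one_add hδ (PowerSeries.ext fun k => ?_)
  have hconv : ∑ ij ∈ antidiagonal k,
      (∑' l : ℕ, (-δ) ^ l * multichoose (a * l + 1) ij.1) * multichoose a ij.2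
      = ∑' l : ℕ, (-δ) ^ l * multichoose (a * (l + 1 : ℕ) + 1) k := by
    simp_rw [← tsum_mul_right]
    rw [← Summable.tsum_finsetSum fun ij _ => (hs ij.1).mul_right _]
    refine tsum_congr fun l => ?_
    rw [show a * ((l + 1 : ℕ) : ℝ) + 1 = (a * l + 1) + a by push_cast; ring,
      ← sum_antidiagonal_multichoose_mul, Finset.mul_sum]
    simp only [mul_assoc]
  rw [mul_add, mul_one, mul_left_comm, map_add, PowerSeries.coeff_C_mul, PowerSeries.coeff_mul]
  simp only [PowerSeries.coeff_mk, coeff_multichooseSeries, Ring.multichoose_one, hconv]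
  rw [(hs k).tsum_eq_zero_add, ← tsum_mul_left]
  simp only [pow_succ, mul_neg, neg_mul, tsum_neg, mul_assoc, mul_left_comm _ δ]
  simp

end DiscreteTail

section MittagLeffler

variable {a : ℝ}

lemma summable_neg_pow_mul_multichoose (ha : 0 < a) {δ : ℝ} (hδ : 0 ≤ δ) (hδ1 : δ < 1) (k : ℕ) :
    Summable fun l : ℕ => (-δ) ^ l * multichoose (a * l + 1) k := by
  obtain ⟨c, hc, hc1⟩ := exists_between hδ1
  have hc0 : 0 < c := hδ.trans_lt hc
  have hw0 : 0 < c ^ a⁻¹ := by positivity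
  have hw1 : c ^ a⁻¹ < 1 := Real.rpow_lt_one hc0.le hc1 (by positivity)
  have hz : 0 < (1 - c ^ a⁻¹) ^ k := pow_pos (by linarith) k
  have hgeom : Summable fun l : ℕ => ((1 - c ^ a⁻¹) ^ k)⁻¹ * (δ / c) ^ l :=
    (summable_geometric_of_lt_one (by positivity) ((div_lt_one hc0).2 hc)).mul_left _
  refine hgeom.of_norm_bounded fun l => ?_
  have hbound : multichoose (a * l + 1) k * (1 - c ^ a⁻¹) ^ k ≤ (c ^ l)⁻¹ := by
    have h := multichoose_add_one_mul_pow_le (s := a * l) (by positivity)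
      (sub_nonneg.2 hw1.le) (by linarith) k
    rwa [sub_sub_cancel, Real.rpow_mul hw0.le, Real.rpow_inv_rpow hc0.le ha.ne',
      Real.rpow_natCast, one_div] at h
  rw [norm_mul, norm_pow, norm_neg, Real.norm_of_nonneg hδ,
    Real.norm_of_nonneg (multichoose_nonneg (by positivity) k), div_pow, div_eq_mul_inv,
    mul_left_comm, inv_mul_eq_div]
  gcongr
  rwa [le_div_iff₀ hz]

lemma rpow_neg_pow {x : ℝ} (hx : 0 ≤ x) (a : ℝ) (l : ℕ) : (x ^ (-a)) ^ l = (x ^ (a * l))⁻¹ := by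
  rw [Real.rpow_neg hx, inv_pow, ← Real.rpow_mul_natCast hx]

lemma exists_norm_neg_pow_mul_multichoose_floor_le (ha : 0 < a) {t : ℝ} (ht : 0 < t) :
    ∃ C : ℝ, ∀ᶠ N : ℕ in atTop, ∀ l : ℕ,
      ‖(-(N : ℝ) ^ (-a)) ^ l * multichoose (a * l + 1) ⌊t * N⌋₊‖ ≤ C * (1 / 2) ^ l := by
  obtain ⟨R, hR, hRt⟩ : ∃ R : ℝ, 0 < R ∧ (2 * t / R) ^ a = 1 / 2 := by
    refine ⟨2 ^ a⁻¹ * (2 * t), by positivity, ?_⟩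
    rw [div_mul_cancel_right₀ (by positivity), Real.inv_rpow (by positivity),
      Real.rpow_inv_rpow (by norm_num) ha.ne', one_div]
  refine ⟨Real.exp R, ?_⟩
  filter_upwards [eventually_gt_atTop 0, eventually_ge_atTop ⌈R / t⌉₊] with N hN hNR l
  have hN0 : (0 : ℝ) < N := by exact_mod_cast hN
  have hfloor : (⌊t * N⌋₊ : ℝ) + R ≤ N * (2 * t) := by
    have h1 := Nat.floor_le (show 0 ≤ t * N by positivity)
    have h2 : R ≤ N * t := (div_le_iff₀ ht).1 (Nat.ceil_le.1 hNR)
    linarith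
  rw [norm_mul, norm_pow, norm_neg, Real.norm_of_nonneg (by positivity), rpow_neg_pow hN0.le,
    Real.norm_of_nonneg (multichoose_nonneg (by positivity) _), inv_mul_le_iff₀ (by positivity)]
  calc multichoose (a * l + 1) ⌊t * N⌋₊
    _ ≤ Real.exp R * ((⌊t * N⌋₊ + R) / R) ^ (a * l) :=
      multichoose_add_one_le_exp_mul_rpow (by positivity) hR _
    _ ≤ Real.exp R * (N * (2 * t / R)) ^ (a * l) := by
      rw [mul_div_assoc']
      gcongr
    _ = N ^ (a * l) * (Real.exp R * (1 / 2) ^ l) := by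
      rw [Real.mul_rpow (by positivity) (by positivity), Real.rpow_mul (x := 2 * t / R)
        (by positivity), hRt, Real.rpow_natCast]
      ring

lemma tendsto_neg_pow_mul_multichoose_floor (ha : 0 ≤ a) {t : ℝ} (ht : 0 < t) (l : ℕ) :
    Tendsto (fun N : ℕ => (-(N : ℝ) ^ (-a)) ^ l * multichoose (a * l + 1) ⌊t * N⌋₊) atTop
      (𝓝 ((-t ^ a) ^ l / Real.Gamma (1 + a * l))) := by
  have h := (tendsto_inv_rpow_mul_multichoose_floor (s := a * l) (by positivity) ht).const_mul
    ((-1 : ℝ) ^ l)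
  rw [Real.rpow_mul ht.le, Real.rpow_natCast, mul_div_assoc', ← neg_pow] at h
  refine h.congr fun N => ?_
  rw [neg_pow ((N : ℝ) ^ (-a)), rpow_neg_pow N.cast_nonneg, mul_assoc]

lemma mittagLeffler_zero_right (a : ℝ) : mittagLeffler a 1 0 = 1 := by
  rw [mittagLeffler, tsum_eq_single 0 fun l hl => by simp [hl]]
  simp

lemma tendsto_natCast_rpow_neg (ha : 0 < a) :
    Tendsto (fun N : ℕ => (N : ℝ) ^ (-a)) atTop (𝓝 0) :=
  (tendsto_rpow_neg_atTop ha).comp tendsto_natCast_atTop_atTop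

lemma tendsto_coeff_discreteTail (ha : 0 < a) {t : ℝ} (ht : 0 ≤ t) :
    Tendsto (fun N : ℕ => PowerSeries.coeff ⌊t * N⌋₊ (discreteTail a ((N : ℝ) ^ (-a)))) atTop
      (𝓝 (mittagLeffler a 1 (-t ^ a))) := by
  have hδ := tendsto_natCast_rpow_neg ha
  rcases ht.eq_or_lt with rfl | ht
  · rw [Real.zero_rpow ha.ne', neg_zero, mittagLeffler_zero_right]
    simpa [discreteTail] using (hδ.const_add 1).inv₀ (by norm_num)
  obtain ⟨C, hC⟩ := exists_norm_neg_pow_mul_multichoose_floor_le ha ht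
  have hgeom : Summable fun l : ℕ => C * (1 / 2 : ℝ) ^ l := summable_geometric_two.mul_left C
  refine (tendsto_tsum_of_dominated_convergence hgeom
    (tendsto_neg_pow_mul_multichoose_floor ha.le ht) hC).congr' ?_
  filter_upwards [hδ.eventually_lt_const one_pos] with N hN
  have hN0 : 0 ≤ (N : ℝ) ^ (-a) := by positivity
  exact (coeff_discreteTail_eq_tsum hN0 _ (summable_neg_pow_mul_multichoose ha hN0 hN)).symm

lemma mittagLeffler_neg_nonneg (ha : 0 < a) (ha1 : a ≤ 1) {x : ℝ} (hx : 0 ≤ x) :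
    0 ≤ mittagLeffler a 1 (-x) := by
  rw [← Real.rpow_inv_rpow hx ha.ne']
  exact ge_of_tendsto' (tendsto_coeff_discreteTail ha (by positivity)) fun N =>
    coeff_discreteTail_nonneg ha.le ha1 (by positivity) _

lemma antitoneOn_mittagLeffler_neg (ha : 0 < a) (ha1 : a ≤ 1) :
    AntitoneOn (fun x => mittagLeffler a 1 (-x)) (Set.Ici 0) := by
  intro x hx y hy hxy
  rw [Set.mem_Ici] at hx hy
  simp only
  rw [← Real.rpow_inv_rpow hx ha.ne', ← Real.rpow_inv_rpow hy ha.ne']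
  refine le_of_tendsto_of_tendsto' (tendsto_coeff_discreteTail ha (by positivity))
    (tendsto_coeff_discreteTail ha (by positivity)) fun N =>
      antitone_coeff_discreteTail ha.le ha1 (by positivity) (Nat.floor_le_floor ?_)
  gcongr

lemma mittagLeffler_neg_le (ha : 0 < a) (ha1 : a ≤ 1) {x : ℝ} (hx : 0 < x) :
    mittagLeffler a 1 (-x) ≤ (1 + x / Real.Gamma (1 + a))⁻¹ := by
  have : 0 < Real.Gamma (1 + a) := Real.Gamma_pos_of_pos (by linarith)
  rw [← one_div, le_div_iff₀ (by positivity)]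
  have ht : 0 < x ^ a⁻¹ := by positivity
  rw [← Real.rpow_inv_rpow hx.le ha.ne']
  refine le_of_tendsto' ((tendsto_coeff_discreteTail ha ht.le).mul
    ((tendsto_inv_rpow_mul_multichoose_floor ha.le ht).const_add 1)) fun N => ?_
  rw [← Real.rpow_neg N.cast_nonneg]
  exact coeff_discreteTail_mul_le_one ha.le ha1 (by positivity) _

lemma tendsto_mittagLeffler_neg (ha : 0 < a) (ha1 : a ≤ 1) :
    Tendsto (fun x => mittagLeffler a 1 (-x)) atTop (𝓝 0) := by
  have hG : 0 < Real.Gamma (1 + a) := Real.Gamma_pos_of_pos (by linarith)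
  have h : Tendsto (fun x : ℝ => (1 + x / Real.Gamma (1 + a))⁻¹) atTop (𝓝 0) :=
    (tendsto_atTop_add_const_left _ _ (tendsto_id.atTop_div_const hG)).inv_tendsto_atTop
  refine tendsto_of_tendsto_of_tendsto_of_le_of_le' tendsto_const_nhds h ?_ ?_
  · filter_upwards [eventually_ge_atTop 0] with x hx using mittagLeffler_neg_nonneg ha ha1 hx
  · filter_upwards [eventually_gt_atTop 0] with x hx using mittagLeffler_neg_le ha ha1 hx

lemma summable_pow_div_Gamma (ha : 0 < a) (z : ℝ) :
    Summable fun l : ℕ => z ^ l / Real.Gamma (1 + a * l) := by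
  have (l : ℕ) : 0 < Real.Gamma (1 + a * l) := Real.Gamma_pos_of_pos (by positivity)
  have hx : 0 < |z| + 1 := by positivity
  obtain ⟨C, hC⟩ := exists_norm_neg_pow_mul_multichoose_floor_le ha
    (show 0 < (|z| + 1) ^ a⁻¹ by positivity)
  refine (summable_geometric_two.mul_left C).of_norm_bounded fun l => ?_
  have h := le_of_tendsto (tendsto_neg_pow_mul_multichoose_floor ha.le
    (show 0 < (|z| + 1) ^ a⁻¹ by positivity) l).norm (hC.mono fun N hN => hN l)
  refine le_trans ?_ h
  rw [Real.rpow_inv_rpow hx.le ha.ne', norm_div, norm_div, norm_pow, norm_pow, norm_neg,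
    Real.norm_of_nonneg hx.le, Real.norm_eq_abs]
  gcongr
  linarith

lemma analyticOnNhd_mittagLeffler (ha : 0 < a) :
    AnalyticOnNhd ℝ (mittagLeffler a 1) Set.univ := by
  set p := FormalMultilinearSeries.ofScalars ℝ (𝕜 := ℝ) fun l : ℕ => (Real.Gamma (1 + a * l))⁻¹
  have hrad : p.radius = ⊤ := by
    refine p.radius_eq_top_of_summable_norm fun r => (summable_pow_div_Gamma ha r).congr fun l => ?_
    have : 0 < Real.Gamma (1 + a * l) := Real.Gamma_pos_of_pos (by positivity)
    rw [FormalMultilinearSeries.ofScalars_norm, Real.norm_of_nonneg (by positivity),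
      div_eq_inv_mul]
  have hsum : p.sum = mittagLeffler a 1 := by
    ext z
    simp only [FormalMultilinearSeries.sum, p, FormalMultilinearSeries.ofScalars_apply_eq,
      mittagLeffler, smul_eq_mul, div_eq_inv_mul]
  have h := p.hasFPowerSeriesOnBall (hrad ▸ ENNReal.zero_lt_top)
  rw [hsum, hrad] at h
  exact fun z _ => h.analyticAt_of_mem (by simp)

lemma strictAntiOn_mittagLeffler_neg (ha : 0 < a) (ha1 : a ≤ 1) :
    StrictAntiOn (fun x => mittagLeffler a 1 (-x)) (Set.Ici 0) := by
  have hanti := antitoneOn_mittagLeffler_neg ha ha1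
  intro x hx y hy hxy
  refine lt_of_le_of_ne (hanti hx hy hxy.le) fun heq => ?_
  have hconst : ∀ w ∈ Set.Ioo x y, mittagLeffler a 1 (-w) = mittagLeffler a 1 (-x) := by
    intro w hw
    have hw0 : w ∈ Set.Ici (0 : ℝ) := (Set.mem_Ici.1 hx).trans hw.1.le
    exact le_antisymm (hanti hx hw0 hw.1.le) (heq.symm.le.trans (hanti hw0 hy hw.2.le))
  -- A function analytic on the line that is constant on an interval is constant.
  obtain ⟨m, hm⟩ := exists_between hxy
  have hall := (analyticOnNhd_mittagLeffler ha).eqOn_of_preconnected_of_eventuallyEq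
    (g := fun _ => mittagLeffler a 1 (-x)) analyticOnNhd_const isPreconnected_univ
    (Set.mem_univ (-m)) (by
      filter_upwards [Ioo_mem_nhds (neg_lt_neg hm.2) (neg_lt_neg hm.1)] with w hw
      have := hconst (-w) ⟨by linarith [hw.2], by linarith [hw.1]⟩
      rwa [neg_neg] at this)
  have hone : mittagLeffler a 1 (-1) = 1 :=
    (hall (Set.mem_univ _)).trans ((hall (Set.mem_univ 0)).symm.trans (mittagLeffler_zero_right a))
  have hG : 0 < 1 / Real.Gamma (1 + a) := one_div_pos.2 (Real.Gamma_pos_of_pos (by linarith))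
  have hlt := mittagLeffler_neg_le ha ha1 one_pos
  rw [hone, one_le_inv₀ (by positivity)] at hlt
  linarith

end MittagLeffler

section ScaledComparison

variable {κ ν : Measure ℝ}

lemma ae_pos_of_cdf_zero [IsProbabilityMeasure ν] (hν : cdf ν 0 = 0) : ∀ᵐ y ∂ν, 0 < y := by
  have h : ν (Set.Iic 0) = 0 := by rw [← ofReal_cdf, hν, ENNReal.ofReal_zero]
  filter_upwards [measure_eq_zero_iff_ae_notMem.1 h] with y hy using not_le.1 hy

lemma norm_cdf_le_one (κ : Measure ℝ) (t : ℝ) : ‖cdf κ t‖ ≤ 1 := by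
  rw [Real.norm_of_nonneg (cdf_nonneg κ t)]
  exact cdf_le_one κ t

lemma integrable_cdf_const_mul [IsFiniteMeasure ν] (κ : Measure ℝ) (r : ℝ) :
    Integrable (fun y => cdf κ (r * y)) ν :=
  .of_bound ((monotone_cdf κ).measurable.comp (measurable_const_mul r)).aestronglyMeasurable 1
    (ae_of_all _ fun _ => norm_cdf_le_one κ _)

lemma continuous_integral_cdf_const_mul [IsFiniteMeasure ν] (hκ : Continuous (cdf κ)) :
    Continuous fun r => ∫ y, cdf κ (r * y) ∂ν :=
  continuous_of_dominated (fun r => (integrable_cdf_const_mul κ r).aestronglyMeasurable)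
    (fun _ => ae_of_all _ fun _ => norm_cdf_le_one κ _) (integrable_const 1)
    (ae_of_all _ fun _ => hκ.comp (continuous_mul_const _))

lemma tendsto_integral_cdf_const_mul_atTop [IsProbabilityMeasure ν] (hν : ∀ᵐ y ∂ν, 0 < y) :
    Tendsto (fun r => ∫ y, cdf κ (r * y) ∂ν) atTop (𝓝 1) := by
  have h : Tendsto (fun r => ∫ y, cdf κ (r * y) ∂ν) atTop (𝓝 (∫ _, (1 : ℝ) ∂ν)) := by
    refine tendsto_integral_filter_of_dominated_convergence (fun _ => 1)
      (.of_forall fun r => (integrable_cdf_const_mul κ r).aestronglyMeasurable)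
      (.of_forall fun _ => ae_of_all _ fun _ => norm_cdf_le_one κ _) (integrable_const 1) ?_
    filter_upwards [hν] with y hy
    exact (tendsto_cdf_atTop κ).comp (tendsto_id.atTop_mul_const hy)
  simpa using h

lemma strictMonoOn_integral_cdf_const_mul [IsProbabilityMeasure ν]
    (hκ : StrictMonoOn (cdf κ) (Set.Ici 0)) (hν : ∀ᵐ y ∂ν, 0 < y) :
    StrictMonoOn (fun r => ∫ y, cdf κ (r * y) ∂ν) (Set.Ici 0) := by
  intro r hr s hs hrs
  have hlt : ∀ᵐ y ∂ν, cdf κ (r * y) < cdf κ (s * y) := by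
    filter_upwards [hν] with y hy using
      hκ (mul_nonneg hr hy.le) (mul_nonneg hs hy.le) (mul_lt_mul_of_pos_right hrs hy)
  have hdiff : ∀ᵐ y ∂ν, 0 < cdf κ (s * y) - cdf κ (r * y) := hlt.mono fun _ => sub_pos.2
  have hintr := integrable_cdf_const_mul (ν := ν) κ r
  have hints := integrable_cdf_const_mul (ν := ν) κ s
  simp only
  rw [← sub_pos, ← integral_sub hints hintr, integral_pos_iff_support_of_nonneg_ae
    (hdiff.mono fun _ => le_of_lt) (hints.sub hintr)]
  have hsupp : Function.support (fun y => cdf κ (s * y) - cdf κ (r * y)) =ᵐ[ν] Set.univ :=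
    eventuallyEq_univ.2 (hdiff.mono fun _ => ne_of_gt)
  rw [measure_congr hsupp, measure_univ]
  exact one_pos

lemma exists_integral_cdf_const_mul_eq [IsProbabilityMeasure ν] (hκ : Continuous (cdf κ))
    (hκ0 : cdf κ 0 = 0) (hν : ∀ᵐ y ∂ν, 0 < y) {c : ℝ} (hc : 0 < c) (hc1 : c < 1) :
    ∃ r, 0 < r ∧ ∫ y, cdf κ (r * y) ∂ν = c := by
  obtain ⟨s, hs, hs0⟩ := (((tendsto_integral_cdf_const_mul_atTop (κ := κ) hν).eventually_const_lt
    hc1).and (eventually_ge_atTop 0)).exists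
  have hzero : ∫ y, cdf κ (0 * y) ∂ν = 0 := by simp [hκ0]
  obtain ⟨r, hr, hrc⟩ := intermediate_value_Icc hs0
    (continuous_integral_cdf_const_mul hκ (ν := ν)).continuousOn ⟨hzero.trans_le hc.le, hs.le⟩
  refine ⟨r, hr.1.lt_of_ne ?_, hrc⟩
  rintro rfl
  exact hc.ne (hzero.symm.trans hrc)

lemma measure_Iio_eq_ofReal_cdf [IsProbabilityMeasure κ] (hκ : Continuous (cdf κ)) (t : ℝ) :
    κ (Set.Iio t) = ENNReal.ofReal (cdf κ t) := by
  nth_rw 1 [← measure_cdf κ]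
  rw [StieltjesFunction.measure_Iio _ (tendsto_cdf_atBot κ), sub_zero,
    hκ.continuousAt.continuousWithinAt.leftLim_eq]

variable {Ω : Type*} [MeasurableSpace Ω] {P : Measure Ω} [IsProbabilityMeasure P] {U V : Ω → ℝ}

lemma measureReal_lt_const_mul (hU : Measurable U) (hV : Measurable V) (hUV : IndepFun U V P)
    (hc : Continuous (cdf (P.map U))) (r : ℝ) :
    P.real {ω | U ω < r * V ω} = ∫ y, cdf (P.map U) (r * y) ∂(P.map V) := by
  have := Measure.isProbabilityMeasure_map (μ := P) hU.aemeasurable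
  have hS : MeasurableSet {q : ℝ × ℝ | q.1 < r * q.2} :=
    measurableSet_lt measurable_fst (measurable_snd.const_mul r)
  have hjoint := (indepFun_iff_map_prod_eq_prod_map_map hU.aemeasurable hV.aemeasurable).1 hUV
  rw [integral_eq_lintegral_of_nonneg_ae (ae_of_all _ fun _ => cdf_nonneg _ _)
    (integrable_cdf_const_mul _ r).aestronglyMeasurable]
  calc P.real {ω | U ω < r * V ω}
    _ = ((P.map U).prod (P.map V)).real {q | q.1 < r * q.2} := by
      rw [← hjoint, map_measureReal_apply (hU.prodMk hV) hS, Set.preimage_ofPred_eq]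
    _ = (∫⁻ y, (P.map U) (Set.Iio (r * y)) ∂(P.map V)).toReal := by
      rw [measureReal_def, Measure.prod_apply_symm hS]
      rfl
    _ = (∫⁻ y, ENNReal.ofReal (cdf (P.map U) (r * y)) ∂(P.map V)).toReal := by
      simp only [measure_Iio_eq_ofReal_cdf hc]

end ScaledComparison

section MittagLefflerLaw

variable {a b : ℝ}

lemma mittagLefflerCDF_one_eq (ha : a ≠ 0) (t : ℝ) :
    mittagLefflerCDF a 1 t = 1 - mittagLeffler a 1 (-(max t 0) ^ a) := by
  rw [mittagLefflerCDF]
  split_ifs with h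
  · rw [max_eq_right h.le, Real.zero_rpow ha, neg_zero, mittagLeffler_zero_right, sub_self]
  · rw [max_eq_left (not_lt.1 h), one_mul]

lemma mittagLefflerCDF_eq_one_mul {r : ℝ} (hr : 0 < r) (a t : ℝ) :
    mittagLefflerCDF a r t = mittagLefflerCDF a 1 (r * t) := by
  simp only [mittagLefflerCDF, mul_neg_iff, hr, hr.not_gt, true_and, false_and, or_false, one_mul]

lemma mittagLefflerCDF_one_of_nonpos (ha : a ≠ 0) {t : ℝ} (ht : t ≤ 0) :
    mittagLefflerCDF a 1 t = 0 := by
  rw [mittagLefflerCDF_one_eq ha, max_eq_right ht, Real.zero_rpow ha, neg_zero,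
    mittagLeffler_zero_right, sub_self]

lemma continuous_mittagLefflerCDF_one (ha : 0 < a) : Continuous (mittagLefflerCDF a 1) := by
  have h : Continuous (mittagLeffler a 1) :=
    continuousOn_univ.1 (analyticOnNhd_mittagLeffler ha).continuousOn
  rw [funext (mittagLefflerCDF_one_eq ha.ne')]
  exact continuous_const.sub (h.comp
    ((continuous_id.max continuous_const).rpow_const fun _ => Or.inr ha.le).neg)

lemma strictMonoOn_mittagLefflerCDF_one (ha : a ∈ Set.Ioc 0 1) :
    StrictMonoOn (mittagLefflerCDF a 1) (Set.Ici 0) := by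
  intro s hs t ht hst
  rw [Set.mem_Ici] at hs ht
  rw [mittagLefflerCDF_one_eq ha.1.ne', mittagLefflerCDF_one_eq ha.1.ne', max_eq_left hs,
    max_eq_left ht]
  exact sub_lt_sub_left (strictAntiOn_mittagLeffler_neg ha.1 ha.2 (Real.rpow_nonneg hs a)
    (Real.rpow_nonneg ht a) (Real.rpow_lt_rpow hs hst ha.1)) 1

lemma monotone_mittagLefflerCDF_one (ha : a ∈ Set.Ioc 0 1) :
    Monotone (mittagLefflerCDF a 1) := by
  have h : Monotone fun t => mittagLefflerCDF a 1 (max t 0) := fun s t hst =>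
    (strictMonoOn_mittagLefflerCDF_one ha).monotoneOn (le_max_right s 0) (le_max_right t 0)
      (max_le_max_right 0 hst)
  convert h using 2 with t
  simp only [mittagLefflerCDF_one_eq ha.1.ne', max_assoc, max_self]

lemma tendsto_mittagLefflerCDF_one_atTop (ha : a ∈ Set.Ioc 0 1) :
    Tendsto (mittagLefflerCDF a 1) atTop (𝓝 1) := by
  have h := ((tendsto_mittagLeffler_neg ha.1 ha.2).comp (tendsto_rpow_atTop ha.1)).const_sub 1
  rw [sub_zero] at h
  refine h.congr' ?_
  filter_upwards [eventually_ge_atTop 0] with t ht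
  rw [mittagLefflerCDF_one_eq ha.1.ne', max_eq_left ht, Function.comp_apply]

lemma exists_cdf_eq_mittagLefflerCDF_one (ha : a ∈ Set.Ioc 0 1) :
    ∃ ν : Measure ℝ, IsProbabilityMeasure ν ∧ ⇑(cdf ν) = mittagLefflerCDF a 1 := by
  let f : StieltjesFunction ℝ := ⟨mittagLefflerCDF a 1, monotone_mittagLefflerCDF_one ha,
    fun t => (continuous_mittagLefflerCDF_one ha.1).continuousWithinAt⟩
  have hbot : Tendsto f atBot (𝓝 0) := by
    refine tendsto_const_nhds.congr' ?_
    filter_upwards [eventually_le_atBot 0] with t ht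
    exact (mittagLefflerCDF_one_of_nonpos ha.1.ne' ht).symm
  have htop : Tendsto f atTop (𝓝 1) := tendsto_mittagLefflerCDF_one_atTop ha
  refine ⟨f.measure, ⟨by rw [f.measure_univ hbot htop, sub_zero, ENNReal.ofReal_one]⟩, ?_⟩
  rw [cdf_measure_stieltjesFunction f hbot htop]

variable {Ω : Type*} [MeasurableSpace Ω] {P : Measure Ω} {lam mu : ℝ} {X Y : ℕ → Ω → ℝ}

lemma IsMittagLefflerClocks.indepFun_left_right (h : IsMittagLefflerClocks P a b lam mu X Y)
    (n : ℕ) : IndepFun (X n) (Y n) P :=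
  h.indep.indepFun (i := Sum.inl n) (j := Sum.inr n) Sum.inl_ne_inr

variable [IsProbabilityMeasure P]

lemma map_const_mul_eq_of_cdf_eq {r : ℝ} (hr : 0 < r) {U : Ω → ℝ} (hU : Measurable U)
    (hcdf : ∀ t, P.real {ω | U ω ≤ t} = mittagLefflerCDF a r t) {κ : Measure ℝ}
    [IsProbabilityMeasure κ] (hκ : ⇑(cdf κ) = mittagLefflerCDF a 1) :
    P.map (fun ω => r * U ω) = κ := by
  have := Measure.isProbabilityMeasure_map (μ := P) (hU.const_mul r).aemeasurable
  refine Measure.eq_of_cdf _ _ (StieltjesFunction.ext fun t => ?_)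
  have hpre : (fun ω => r * U ω) ⁻¹' Set.Iic t = {ω | U ω ≤ t / r} := by
    ext ω
    simp [le_div_iff₀' hr]
  rw [cdf_eq_real, map_measureReal_apply (hU.const_mul r) measurableSet_Iic, hpre, hcdf,
    mittagLefflerCDF_eq_one_mul hr, mul_div_cancel₀ _ hr.ne', hκ]

lemma IsMittagLefflerClocks.measureReal_lt_eq_integral
    (h : IsMittagLefflerClocks P a b lam mu X Y) (ha : 0 < a) (hlam : 0 < lam) (hmu : 0 < mu)
    {κ ν : Measure ℝ} [IsProbabilityMeasure κ] [IsProbabilityMeasure ν]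
    (hκ : ⇑(cdf κ) = mittagLefflerCDF a 1) (hν : ⇑(cdf ν) = mittagLefflerCDF b 1) :
    P.real {ω | X 0 ω < Y 0 ω} = ∫ y, cdf κ (lam / mu * y) ∂ν := by
  have hmapX := map_const_mul_eq_of_cdf_eq hlam (h.measurable_left 0) (h.cdf_left 0) hκ
  have hmapY := map_const_mul_eq_of_cdf_eq hmu (h.measurable_right 0) (h.cdf_right 0) hν
  have hint := measureReal_lt_const_mul ((h.measurable_left 0).const_mul lam)
    ((h.measurable_right 0).const_mul mu)
    ((h.indepFun_left_right 0).comp (measurable_const_mul lam) (measurable_const_mul mu))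
    (by rw [hmapX, hκ]; exact continuous_mittagLefflerCDF_one ha) (lam / mu)
  rw [hmapX, hmapY] at hint
  rw [← hint]
  congr! 3 with ω
  rw [← mul_assoc, div_mul_cancel₀ _ hmu.ne', mul_lt_mul_iff_right₀ hlam]

lemma exists_criticalRatio (ha : a ∈ Set.Ioc 0 1) (hb : b ∈ Set.Ioc 0 1) :
    ∃ ρ : ℝ, 0 < ρ ∧ ∀ lam mu : ℝ, 0 < lam → 0 < mu →
      ∀ (Ω : Type*) [MeasurableSpace Ω] (P : Measure Ω) [IsProbabilityMeasure P]
        (X Y : ℕ → Ω → ℝ), IsMittagLefflerClocks P a b lam mu X Y →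
        (P.real {ω | X 0 ω < Y 0 ω} < 1 / 2 ↔ lam / mu < ρ) ∧
          (P.real {ω | X 0 ω < Y 0 ω} = 1 / 2 ↔ lam / mu = ρ) := by
  obtain ⟨κ, _, hκ⟩ := exists_cdf_eq_mittagLefflerCDF_one ha
  obtain ⟨ν, _, hν⟩ := exists_cdf_eq_mittagLefflerCDF_one hb
  have hκ0 : cdf κ 0 = 0 := by rw [hκ, mittagLefflerCDF_one_of_nonpos ha.1.ne' le_rfl]
  have hν0 : ∀ᵐ y ∂ν, 0 < y :=
    ae_pos_of_cdf_zero (by rw [hν, mittagLefflerCDF_one_of_nonpos hb.1.ne' le_rfl])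
  have hmono : StrictMonoOn (fun r => ∫ y, cdf κ (r * y) ∂ν) (Set.Ici 0) :=
    strictMonoOn_integral_cdf_const_mul (hκ ▸ strictMonoOn_mittagLefflerCDF_one ha) hν0
  obtain ⟨ρ, hρ, hhalf⟩ := exists_integral_cdf_const_mul_eq (c := 1 / 2)
    (hκ ▸ continuous_mittagLefflerCDF_one ha.1) hκ0 hν0 (by norm_num) (by norm_num)
  refine ⟨ρ, hρ, fun lam mu hlam hmu Ω _ P _ X Y h => ?_⟩
  rw [h.measureReal_lt_eq_integral ha.1 hlam hmu hκ hν]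
  refine ⟨?_, ?_⟩
  · rw [← hhalf]
    exact hmono.lt_iff_lt (div_pos hlam hmu).le hρ.le
  · rw [← hhalf]
    exact hmono.eq_iff_eq (div_pos hlam hmu).le hρ.le

end MittagLefflerLaw

section Paths

variable {Ω : Type*}

/-- The effect of the `n`-th pair of clocks on the queue length: `+1` for an arrival, `-1` for a
departure attempt. -/
noncomputable def step (X Y : ℕ → Ω → ℝ) (n : ℕ) (ω : Ω) : ℤ := if X n ω < Y n ω then 1 else -1

/-- The simple random walk with increments `step`; the embedded queue is its reflection at zero. -/
noncomputable def walk (X Y : ℕ → Ω → ℝ) (n : ℕ) (ω : Ω) : ℤ :=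
  ∑ k ∈ Finset.range n, step X Y k ω

/-- The queue length after `n` events, started from `i` customers, when the first `n` events act
in reversed order. -/
noncomputable def revQueue (X Y : ℕ → Ω → ℝ) : ℕ → ℕ → Ω → ℕ
  | 0, i, _ => i
  | n + 1, i, ω => revQueue X Y n (if X n ω < Y n ω then i + 1 else i - 1) ω

variable (X Y : ℕ → Ω → ℝ) (ω : Ω)

@[simp] lemma walk_zero : walk X Y 0 ω = 0 := rfl

lemma walk_succ (n : ℕ) : walk X Y (n + 1) ω = walk X Y n ω + step X Y n ω :=
  Finset.sum_range_succ _ _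

lemma natCast_embeddedQueue_succ (i n : ℕ) : (embeddedQueue X Y i (n + 1) ω : ℤ) =
    max (embeddedQueue X Y i n ω + step X Y n ω) 0 := by
  rw [embeddedQueue, step]
  split_ifs <;> push_cast <;> omega

lemma add_walk_le_embeddedQueue (i n : ℕ) :
    (i : ℤ) + walk X Y n ω ≤ embeddedQueue X Y i n ω := by
  induction n with
  | zero => simp [embeddedQueue]
  | succ n ih =>
    rw [natCast_embeddedQueue_succ, walk_succ]
    exact le_max_of_le_left (by linarith)

section Reversal

lemma embeddedQueue_succ_eq_shift (i n : ℕ) : embeddedQueue X Y i (n + 1) ω =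
    embeddedQueue (fun k => X (k + 1)) (fun k => Y (k + 1))
      (if X 0 ω < Y 0 ω then i + 1 else i - 1) n ω := by
  induction n with
  | zero => rfl
  | succ n ih => rw [embeddedQueue, ih, embeddedQueue]

variable {X Y} in
lemma embeddedQueue_eq_revQueue {X' Y' : ℕ → Ω → ℝ} (m i : ℕ)
    (hX : ∀ k < m, X' k ω = X (m - 1 - k) ω) (hY : ∀ k < m, Y' k ω = Y (m - 1 - k) ω) :
    embeddedQueue X' Y' i m ω = revQueue X Y m i ω := by
  induction m generalizing i X' Y' with
  | zero => rfl
  | succ m ih =>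
    rw [embeddedQueue_succ_eq_shift, revQueue, hX 0 m.succ_pos, hY 0 m.succ_pos]
    refine ih _ (fun k hk => ?_) fun k hk => ?_
    · rw [hX (k + 1) (by omega)]
      congr 1
      omega
    · rw [hY (k + 1) (by omega)]
      congr 1
      omega

lemma partialSups_walk_nonneg (n : ℕ) : 0 ≤ partialSups (walk X Y · ω) n :=
  le_partialSups_of_le (walk X Y · ω) n.zero_le

lemma revQueue_eq_max (n i : ℕ) :
    (revQueue X Y n i ω : ℤ) = max (i + walk X Y n ω) (partialSups (walk X Y · ω) n) := by
  induction n generalizing i with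
  | zero => simp [revQueue]
  | succ n ih =>
    have hle : walk X Y n ω ≤ _ := le_partialSups (walk X Y · ω) n
    rw [revQueue, ih, partialSups_add_one, walk_succ, step]
    split_ifs <;> push_cast <;> omega

variable {X Y ω}

lemma exists_eventually_revQueue_eq (h : Tendsto (walk X Y · ω) atTop atBot) :
    ∃ c : ℕ, ∀ i, ∀ᶠ n in atTop, revQueue X Y n i ω = c := by
  obtain ⟨N, hN⟩ := eventually_atTop.1 (h.eventually_le_atBot 0)
  have hmax : ∀ n ≥ N, partialSups (walk X Y · ω) n = partialSups (walk X Y · ω) N := by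
    refine fun n hn => le_antisymm (partialSups_le _ _ _ fun k _ => ?_) (partialSups_monotone _ hn)
    rcases le_total k N with hk | hk
    · exact le_partialSups_of_le (walk X Y · ω) hk
    · exact (hN k hk).trans (partialSups_walk_nonneg X Y ω N)
  refine ⟨(partialSups (walk X Y · ω) N).toNat, fun i => ?_⟩
  filter_upwards [eventually_ge_atTop N, h.eventually_le_atBot (-i)] with n hn hi
  have hrev := revQueue_eq_max X Y ω n i
  have hnonneg := partialSups_walk_nonneg X Y ω N
  rw [hmax n hn, max_eq_right (by omega)] at hrev
  omega

end Reversal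

section Recurrence

variable {X Y ω}

lemma frequently_embeddedQueue_eq_zero (i : ℕ) (h : ¬ BddBelow (Set.range (walk X Y · ω))) :
    ∃ᶠ n in atTop, embeddedQueue X Y i n ω = 0 := by
  contrapose! h
  obtain ⟨N, hN⟩ := eventually_atTop.1 h
  -- As long as the queue is never empty, it moves in parallel to the walk.
  have hparallel : ∀ n ≥ N, (embeddedQueue X Y i n ω : ℤ) - walk X Y n ω =
      embeddedQueue X Y i N ω - walk X Y N ω := by
    intro n hn
    induction n, hn using Nat.le_induction with
    | base => rfl
    | succ n hn ih =>
      have hsucc := natCast_embeddedQueue_succ X Y ω i n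
      have hne := hN (n + 1) (by omega)
      rw [walk_succ]
      omega
  refine IsBoundedUnder.bddBelow_range ⟨walk X Y N ω - embeddedQueue X Y i N ω, eventually_map.2 ?_⟩
  filter_upwards [eventually_ge_atTop N] with n hn
  have := hparallel n hn
  omega

lemma frequently_le_embeddedQueue (i j : ℕ) (h : ¬ BddAbove (Set.range (walk X Y · ω))) :
    ∃ᶠ n in atTop, j ≤ embeddedQueue X Y i n ω := by
  contrapose! h
  refine IsBoundedUnder.bddAbove_range ⟨j, eventually_map.2 ?_⟩
  filter_upwards [h] with n hn
  have := add_walk_le_embeddedQueue X Y ω i n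
  omega

lemma frequently_embeddedQueue_eq (i j : ℕ) (hbelow : ¬ BddBelow (Set.range (walk X Y · ω)))
    (habove : ¬ BddAbove (Set.range (walk X Y · ω))) :
    ∃ᶠ n in atTop, embeddedQueue X Y i n ω = j := by
  refine frequently_atTop.2 fun N => ?_
  obtain ⟨m, hm, hm0⟩ := frequently_atTop.1 (frequently_embeddedQueue_eq_zero i hbelow) N
  obtain ⟨n, hn, hnj⟩ := frequently_atTop.1 (frequently_le_embeddedQueue i j habove) m
  by_contra! hmiss
  -- The queue grows by at most one at each event, hence cannot jump over `j`.
  have hlt : ∀ k ≥ m, embeddedQueue X Y i k ω < j := by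
    intro k hk
    induction k, hk using Nat.le_induction with
    | base =>
      have := hmiss m hm
      omega
    | succ k hk ih =>
      have hne := hmiss (k + 1) (by omega)
      rw [embeddedQueue] at hne ⊢
      split_ifs at hne ⊢ <;> omega
  exact (hlt n hn).not_ge hnj

end Recurrence

end Paths

section Clocks

lemma iIndepFun_prodMk_of_sumElim {Ω ι α : Type*} [MeasurableSpace Ω] [MeasurableSpace α]
    {P : Measure Ω} {X Y : ι → Ω → α} (hX : ∀ n, Measurable (X n)) (hY : ∀ n, Measurable (Y n))
    (h : iIndepFun (Sum.elim X Y) P) : iIndepFun (fun n ω => (X n ω, Y n ω)) P := by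
  have hpair (n : ι) : IndepFun (X n) (Y n) P :=
    h.indepFun (i := Sum.inl n) (j := Sum.inr n) Sum.inl_ne_inr
  refine (iIndepFun_iff_iIndep _ _ _).2 (iIndepSets.iIndep
    (fun n => ((hX n).prodMk (hY n)).comap_le) _ (fun n => isPiSystem_prod.comap _)
    (fun n => by rw [← generateFrom_prod, MeasurableSpace.comap_generateFrom]; rfl)
    ((iIndepSets_iff _ _).2 fun S f hf => ?_))
  simp only [Set.exists_mem_image2, Set.mem_ofPred_eq, Set.mk_preimage_prod] at hf
  choose! A hA B hB hAB using hf
  have hfactor := (iIndepFun_iff_measure_inter_preimage_eq_mul.1 h) (S.disjSum S)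
    (sets := Sum.elim A B) (by simp +contextual [hA, hB])
  rw [Finset.prod_disjSum, ← Finset.prod_mul_distrib] at hfactor
  rw [← Set.iInter₂_congr hAB, ← Finset.prod_congr rfl fun n hn => congrArg P (hAB n hn)]
  convert hfactor using 1
  · congr 1
    ext ω
    simp only [Set.mem_iInter, Set.mem_inter_iff, Set.mem_preimage, Finset.mem_disjSum]
    aesop
  · exact Finset.prod_congr rfl fun n hn =>
      (hpair n).measure_inter_preimage_eq_mul _ _ (hA n hn) (hB n hn)

variable {Ω : Type*} [MeasurableSpace Ω] {P : Measure Ω} {X Y : ℕ → Ω → ℝ}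

/-- The pairs of clocks `(X n, Y n)` are independent and identically distributed with positive
minimum, and `X n` rings before `Y n` with probability `p`. -/
structure IsIIDClocks (P : Measure Ω) (X Y : ℕ → Ω → ℝ) (p : ℝ) : Prop where
  measurable_left : ∀ n, Measurable (X n)
  measurable_right : ∀ n, Measurable (Y n)
  indep : iIndepFun (fun n ω => (X n ω, Y n ω)) P
  identDistrib : ∀ n, IdentDistrib (fun ω => (X n ω, Y n ω)) (fun ω => (X 0 ω, Y 0 ω)) P P
  prob_zero : P.real {ω | X 0 ω < Y 0 ω} = p
  pos_zero : ∀ᵐ ω ∂P, 0 < min (X 0 ω) (Y 0 ω)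

lemma identDistrib_of_measureReal_le_eq [IsProbabilityMeasure P] {U V : Ω → ℝ}
    (hU : Measurable U) (hV : Measurable V)
    (hUV : ∀ t, P.real {ω | U ω ≤ t} = P.real {ω | V ω ≤ t}) : IdentDistrib U V P P := by
  have := Measure.isProbabilityMeasure_map (μ := P) hU.aemeasurable
  have := Measure.isProbabilityMeasure_map (μ := P) hV.aemeasurable
  refine ⟨hU.aemeasurable, hV.aemeasurable,
    Measure.eq_of_cdf _ _ (StieltjesFunction.ext fun t => ?_)⟩
  rw [cdf_eq_real, cdf_eq_real, map_measureReal_apply hU measurableSet_Iic,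
    map_measureReal_apply hV measurableSet_Iic]
  exact hUV t

lemma ae_pos_of_measureReal_le_eq [IsFiniteMeasure P] {a r : ℝ} (ha : a ≠ 0) (hr : 0 < r)
    {U : Ω → ℝ} (hU : ∀ t, P.real {ω | U ω ≤ t} = mittagLefflerCDF a r t) :
    ∀ᵐ ω ∂P, 0 < U ω := by
  have h := hU 0
  rw [mittagLefflerCDF_eq_one_mul hr, mul_zero, mittagLefflerCDF_one_of_nonpos ha le_rfl,
    measureReal_eq_zero_iff] at h
  simpa only [ae_iff, not_lt] using h

lemma IsMittagLefflerClocks.isIIDClocks [IsProbabilityMeasure P] {a b lam mu : ℝ} (ha : a ≠ 0)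
    (hb : b ≠ 0) (hlam : 0 < lam) (hmu : 0 < mu) (h : IsMittagLefflerClocks P a b lam mu X Y) :
    IsIIDClocks P X Y (P.real {ω | X 0 ω < Y 0 ω}) where
  measurable_left := h.measurable_left
  measurable_right := h.measurable_right
  indep := iIndepFun_prodMk_of_sumElim h.measurable_left h.measurable_right h.indep
  identDistrib n := (identDistrib_of_measureReal_le_eq (h.measurable_left n) (h.measurable_left 0)
    fun t => by rw [h.cdf_left, h.cdf_left]).prodMk
    (identDistrib_of_measureReal_le_eq (h.measurable_right n) (h.measurable_right 0)
      fun t => by rw [h.cdf_right, h.cdf_right])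
    (h.indepFun_left_right n) (h.indepFun_left_right 0)
  prob_zero := rfl
  pos_zero := by
    filter_upwards [ae_pos_of_measureReal_le_eq ha hlam (h.cdf_left 0),
      ae_pos_of_measureReal_le_eq hb hmu (h.cdf_right 0)] with ω hX hY using lt_min hX hY

namespace IsIIDClocks

variable {p : ℝ} (h : IsIIDClocks P X Y p)
include h

lemma measurable_pair (n : ℕ) : Measurable fun ω => (X n ω, Y n ω) :=
  (h.measurable_left n).prodMk (h.measurable_right n)

lemma measurableSet_lt (n : ℕ) : MeasurableSet {ω | X n ω < Y n ω} :=
  _root_.measurableSet_lt (h.measurable_left n) (h.measurable_right n)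

lemma prob (n : ℕ) : P.real {ω | X n ω < Y n ω} = p := by
  rw [← h.prob_zero, measureReal_def, measureReal_def]
  congr 1
  exact (h.identDistrib n).measure_mem_eq
    (_root_.measurableSet_lt measurable_fst measurable_snd)

lemma pos : ∀ᵐ ω ∂P, ∀ n, 0 < min (X n ω) (Y n ω) :=
  ae_all_iff.2 fun n => (h.identDistrib n).symm.ae_mem_snd
    (_root_.measurableSet_lt measurable_const (measurable_fst.min measurable_snd)) h.pos_zero

lemma strongLaw {g : ℝ × ℝ → ℝ} (hg : Measurable g)
    (hint : Integrable (fun ω => g (X 0 ω, Y 0 ω)) P) :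
    ∀ᵐ ω ∂P, Tendsto (fun n : ℕ => (∑ k ∈ Finset.range n, g (X k ω, Y k ω)) / n) atTop
      (𝓝 (∫ ω, g (X 0 ω, Y 0 ω) ∂P)) :=
  strong_law_ae_real (fun n ω => g (X n ω, Y n ω)) hint
    (fun _ _ hmn => (h.indep.indepFun hmn).comp hg hg) fun n => (h.identDistrib n).comp hg

lemma integral_step [IsProbabilityMeasure P] (n : ℕ) :
    ∫ ω, (step X Y n ω : ℝ) ∂P = 2 * p - 1 := by
  have hstep : (fun ω => (step X Y n ω : ℝ)) =
      fun ω => 2 * {ω | X n ω < Y n ω}.indicator 1 ω - 1 := by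
    funext ω
    by_cases hω : X n ω < Y n ω
    · norm_num [step, hω]
    · simp [step, hω]
  have hint : Integrable ({ω | X n ω < Y n ω}.indicator (1 : Ω → ℝ)) P :=
    (integrable_const 1).indicator (h.measurableSet_lt n)
  rw [hstep, integral_sub (hint.const_mul 2) (integrable_const 1), integral_const_mul,
    integral_indicator_one (h.measurableSet_lt n), h.prob]
  simp

lemma tendsto_walk_div [IsProbabilityMeasure P] :
    ∀ᵐ ω ∂P, Tendsto (fun n : ℕ => (walk X Y n ω : ℝ) / n) atTop (𝓝 (2 * p - 1)) := by
  let g : ℝ × ℝ → ℝ := fun q => if q.1 < q.2 then 1 else -1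
  have hg : Measurable g := Measurable.ite
    (_root_.measurableSet_lt measurable_fst measurable_snd) measurable_const measurable_const
  have hstep (n : ℕ) (ω : Ω) : g (X n ω, Y n ω) = (step X Y n ω : ℝ) := by
    simp only [g, step]
    split_ifs <;> simp
  have hint : Integrable (fun ω => g (X 0 ω, Y 0 ω)) P :=
    .of_bound (hg.comp (h.measurable_pair 0)).aestronglyMeasurable 1 <| ae_of_all _ fun ω => by
      simp only [g]
      split_ifs <;> simp
  simpa only [hstep, h.integral_step, walk, Int.cast_sum] using h.strongLaw hg hint

lemma tendsto_walk_atTop [IsProbabilityMeasure P] (hp : 1 / 2 < p) :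
    ∀ᵐ ω ∂P, Tendsto (walk X Y · ω) atTop atTop := by
  filter_upwards [h.tendsto_walk_div] with ω hω
  have hmul := hω.pos_mul_atTop (by linarith) tendsto_natCast_atTop_atTop
  refine (tendsto_intCast_atTop_iff (R := ℝ)).1 (hmul.congr' ?_)
  filter_upwards [eventually_ne_atTop 0] with n hn using div_mul_cancel₀ _ (Nat.cast_ne_zero.2 hn)

lemma tendsto_walk_atBot [IsProbabilityMeasure P] (hp : p < 1 / 2) :
    ∀ᵐ ω ∂P, Tendsto (walk X Y · ω) atTop atBot := by
  filter_upwards [h.tendsto_walk_div] with ω hω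
  have hmul := hω.neg_mul_atTop (by linarith) tendsto_natCast_atTop_atTop
  refine (tendsto_intCast_atBot_iff (R := ℝ)).1 (hmul.congr' ?_)
  filter_upwards [eventually_ne_atTop 0] with n hn using div_mul_cancel₀ _ (Nat.cast_ne_zero.2 hn)

lemma isTransient [IsProbabilityMeasure P] (hp : 1 / 2 < p) :
    IsTransient P (embeddedQueue X Y) := by
  intro i
  refine measure_eq_zero_iff_ae_notMem.2 ?_
  filter_upwards [h.tendsto_walk_atTop hp] with ω hω
  refine not_frequently.2 ?_
  filter_upwards [hω.eventually_gt_atTop 0] with n hn heq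
  have := add_walk_le_embeddedQueue X Y ω i n
  omega

lemma tendsto_eventTime [IsProbabilityMeasure P] :
    ∀ᵐ ω ∂P, Tendsto (eventTime X Y · ω) atTop atTop := by
  -- The inter-event times need not be integrable, so they are truncated at `1`.
  let g : ℝ × ℝ → ℝ := fun q => max 0 (min 1 (min q.1 q.2))
  have hg : Measurable g := by fun_prop
  have hint : Integrable (fun ω => g (X 0 ω, Y 0 ω)) P :=
    .of_bound (hg.comp (h.measurable_pair 0)).aestronglyMeasurable 1 <| ae_of_all _ fun ω => by
      simp [g, abs_of_nonneg]
  have hpos : 0 < ∫ ω, g (X 0 ω, Y 0 ω) ∂P := by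
    have hnonneg : 0 ≤ fun ω => g (X 0 ω, Y 0 ω) := fun ω => le_max_left _ _
    rw [integral_pos_iff_support_of_nonneg hnonneg hint]
    have hsupp : Function.support (fun ω => g (X 0 ω, Y 0 ω)) =ᵐ[P] Set.univ := by
      filter_upwards [h.pos_zero] with ω hω
      exact eq_true (lt_max_of_lt_right (lt_min one_pos hω)).ne'
    rw [measure_congr hsupp, measure_univ]
    exact one_pos
  filter_upwards [h.strongLaw hg hint, h.pos] with ω hω hω0
  refine tendsto_atTop_mono' _ ?_ (hω.pos_mul_atTop hpos tendsto_natCast_atTop_atTop)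
  filter_upwards [eventually_ne_atTop 0] with n hn
  rw [div_mul_cancel₀ _ (Nat.cast_ne_zero.2 hn), eventTime]
  exact Finset.sum_le_sum fun k _ => max_le (hω0 k).le (min_le_right _ _)

end IsIIDClocks

end Clocks

section Past

variable {Ω : Type*} {X Y : ℕ → Ω → ℝ}

/-- The σ-algebra of what the first `n` pairs of clocks reveal. -/
@[reducible] def past (X Y : ℕ → Ω → ℝ) (n : ℕ) : MeasurableSpace Ω :=
  ⨆ k ∈ Set.Iio n, MeasurableSpace.comap (fun ω => (X k ω, Y k ω)) inferInstance

lemma past_mono : Monotone (past X Y) := fun _ _ hmn =>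
  biSup_mono fun _ hk => lt_of_lt_of_le hk hmn

lemma measurable_pair_past {n k : ℕ} (hk : k < n) :
    Measurable[past X Y n] fun ω => (X k ω, Y k ω) :=
  measurable_iff_comap_le.2 (le_biSup (f := fun k =>
    MeasurableSpace.comap (fun ω => (X k ω, Y k ω)) inferInstance) (Set.mem_Iio.2 hk))

lemma measurable_embeddedQueue [MeasurableSpace Ω] (i n : ℕ)
    (hX : ∀ k < n, Measurable (X k)) (hY : ∀ k < n, Measurable (Y k)) :
    Measurable (embeddedQueue X Y i n) := by
  induction n with
  | zero => exact measurable_const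
  | succ n ih =>
    have hn := ih (fun k hk => hX k (by omega)) fun k hk => hY k (by omega)
    exact Measurable.ite (measurableSet_lt (hX n n.lt_succ_self) (hY n n.lt_succ_self))
      ((measurable_from_top (f := fun k : ℕ => k + 1)).comp hn)
      ((measurable_from_top (f := fun k : ℕ => k - 1)).comp hn)

lemma measurable_embeddedQueue_past (i n : ℕ) : Measurable[past X Y n] (embeddedQueue X Y i n) :=
  @measurable_embeddedQueue Ω X Y (past X Y n) i n
    (fun _ hk => measurable_fst.comp (measurable_pair_past hk))
    fun _ hk => measurable_snd.comp (measurable_pair_past hk)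

lemma measurableSet_lt_comap (n : ℕ) : MeasurableSet[MeasurableSpace.comap
    (fun ω => (X n ω, Y n ω)) inferInstance] {ω | X n ω < Y n ω} :=
  ⟨{q : ℝ × ℝ | q.1 < q.2}, measurableSet_lt measurable_fst measurable_snd, rfl⟩

namespace IsIIDClocks

variable [MeasurableSpace Ω] {P : Measure Ω} {p : ℝ} (h : IsIIDClocks P X Y p)
include h

lemma past_le (n : ℕ) : past X Y n ≤ ‹MeasurableSpace Ω› :=
  iSup₂_le fun k _ => (h.measurable_pair k).comap_le

lemma indep_past (n : ℕ) : Indep (past X Y n)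
    (MeasurableSpace.comap (fun ω => (X n ω, Y n ω)) inferInstance) P := by
  have hindep := indep_iSup_of_disjoint (fun k => (h.measurable_pair k).comap_le) h.indep.iIndep
    (S := Set.Iio n) (T := {n}) (by simp)
  rwa [iSup_singleton] at hindep

lemma real_inter_lt {E : Set Ω} {n : ℕ} (hE : MeasurableSet[past X Y n] E) :
    P.real (E ∩ {ω | X n ω < Y n ω}) = P.real E * p := by
  rw [measureReal_def, (Indep_iff _ _ _).1 (h.indep_past n) _ _ hE (measurableSet_lt_comap n),
    ENNReal.toReal_mul, ← measureReal_def, ← measureReal_def, h.prob]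

lemma real_sdiff_lt [IsProbabilityMeasure P] {E : Set Ω} {n : ℕ}
    (hE : MeasurableSet[past X Y n] E) :
    P.real (E \ {ω | X n ω < Y n ω}) = P.real E * (1 - p) := by
  have hsplit := measureReal_sdiff_add_inter (μ := P) (s := E) (h.measurableSet_lt n)
  rw [h.real_inter_lt hE] at hsplit
  linarith

lemma real_embeddedQueue_succ [IsProbabilityMeasure P] (i n j : ℕ) :
    P.real {ω | embeddedQueue X Y i (n + 1) ω = j} =
      P.real {ω | embeddedQueue X Y i n ω + 1 = j} * p +
        P.real {ω | embeddedQueue X Y i n ω - 1 = j} * (1 - p) := by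
  have hpast (s : Set ℕ) : MeasurableSet[past X Y n] {ω | embeddedQueue X Y i n ω ∈ s} :=
    measurable_embeddedQueue_past i n s.to_countable.measurableSet
  have hadd := hpast {k | k + 1 = j}
  have hsub := hpast {k | k - 1 = j}
  simp only [Set.mem_ofPred_eq] at hadd hsub
  rw [← h.real_inter_lt hadd, ← h.real_sdiff_lt hsub, ← measureReal_union]
  · congr 1
    ext ω
    by_cases hω : X n ω < Y n ω <;> simp [embeddedQueue, hω]
  · exact Set.disjoint_left.2 fun ω hω hω' => hω'.2 hω.2
  · exact (h.past_le n _ hsub).diff (h.measurableSet_lt n)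

end IsIIDClocks

end Past

section EventTimes

variable {Ω : Type*} {X Y : ℕ → Ω → ℝ} {ω : Ω}

lemma eventTime_succ (n : ℕ) :
    eventTime X Y (n + 1) ω = eventTime X Y n ω + min (X n ω) (Y n ω) :=
  Finset.sum_range_succ _ _

lemma strictMono_eventTime (hpos : ∀ n, 0 < min (X n ω) (Y n ω)) :
    StrictMono (eventTime X Y · ω) := by
  refine strictMono_nat_of_lt_succ fun n => ?_
  rw [eventTime_succ]
  exact lt_add_of_pos_right _ (hpos n)

lemma bddAbove_setOf_eventTime_le (h : Tendsto (eventTime X Y · ω) atTop atTop) (t : ℝ) :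
    BddAbove {n | eventTime X Y n ω ≤ t} := by
  obtain ⟨N, hN⟩ := eventually_atTop.1 (h.eventually_gt_atTop t)
  exact ⟨N, fun n hn => le_of_not_ge fun hNn => (hN n hNn).not_ge hn⟩

lemma eventCount_eq_iff (hmono : StrictMono (eventTime X Y · ω))
    (h : Tendsto (eventTime X Y · ω) atTop atTop) {t : ℝ} (ht : 0 ≤ t) {m : ℕ} :
    eventCount X Y t ω = m ↔ eventTime X Y m ω ≤ t ∧ t < eventTime X Y (m + 1) ω := by
  have hbdd := bddAbove_setOf_eventTime_le h t
  constructor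
  · rintro rfl
    refine ⟨Nat.sSup_mem ⟨0, by simpa [eventTime]⟩ hbdd, lt_of_not_ge fun hle => ?_⟩
    exact (le_csSup hbdd hle).not_gt (Nat.lt_succ_self _)
  · rintro ⟨hle, hlt⟩
    have hIic : {n | eventTime X Y n ω ≤ t} = Set.Iic m := Set.ext fun n =>
      ⟨fun hn => Nat.lt_succ_iff.1 (hmono.lt_iff_lt.1 (hn.trans_lt hlt)),
        fun hn => (hmono.monotone hn).trans hle⟩
    rw [eventCount, hIic, csSup_Iic]

lemma tendsto_eventCount (h : Tendsto (eventTime X Y · ω) atTop atTop) :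
    Tendsto (eventCount X Y · ω) atTop atTop := by
  refine tendsto_atTop.2 fun n => ?_
  filter_upwards [eventually_ge_atTop (eventTime X Y n ω)] with t ht
  exact le_csSup (bddAbove_setOf_eventTime_le h t) ht

variable [MeasurableSpace Ω] (hX : ∀ k, Measurable (X k)) (hY : ∀ k, Measurable (Y k))
include hX hY

lemma measurable_eventTime (n : ℕ) : Measurable (eventTime X Y n) :=
  Finset.measurable_fun_sum _ fun k _ => (hX k).min (hY k)

lemma measurable_eventCount (t : ℝ) : Measurable (eventCount X Y t) := by
  refine measurable_of_Iic fun m => ?_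
  -- The supremum of an unbounded set of natural numbers is `0`.
  have hle : eventCount X Y t ⁻¹' Set.Iic m = {ω | (∀ k, ∃ n, eventTime X Y n ω ≤ t ∧ k < n) ∨
      ∀ n, eventTime X Y n ω ≤ t → n ≤ m} := by
    ext ω
    refine Iff.trans ?_ (or_congr_left (not_bddAbove_iff (s := {n | eventTime X Y n ω ≤ t})))
    by_cases hbdd : BddAbove {n | eventTime X Y n ω ≤ t}
    · simp only [hbdd, not_true_eq_false, false_or]
      exact ⟨fun hm n hn => (le_csSup hbdd hn).trans hm, csSup_le'⟩
    · simp [hbdd, eventCount]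
  rw [hle]
  have hmeas (n : ℕ) : MeasurableSet {ω | eventTime X Y n ω ≤ t} :=
    measurableSet_le (measurable_eventTime hX hY n) measurable_const
  measurability

end EventTimes

section TimeReversal

/-- The permutation of `ℕ` that reverses the order of the first `m` numbers. -/
def reversal (m k : ℕ) : ℕ := if k < m then m - 1 - k else k

lemma reversal_of_lt {m k : ℕ} (hk : k < m) : reversal m k = m - 1 - k := if_pos hk

lemma reversal_self (m : ℕ) : reversal m m = m := if_neg (lt_irrefl m)

lemma reversal_injective (m : ℕ) : Function.Injective (reversal m) := by
  intro k l hkl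
  simp only [reversal] at hkl
  split_ifs at hkl <;> omega

variable {Ω : Type*} {X Y : ℕ → Ω → ℝ}

lemma eventTime_reversal (m : ℕ) (ω : Ω) :
    eventTime (fun k => X (reversal m k)) (fun k => Y (reversal m k)) m ω = eventTime X Y m ω := by
  rw [eventTime, eventTime, ← Finset.sum_range_reflect (fun k => min (X k ω) (Y k ω))]
  exact Finset.sum_congr rfl fun k hk => by rw [reversal_of_lt (Finset.mem_range.1 hk)]

lemma eventTime_reversal_succ (m : ℕ) (ω : Ω) :
    eventTime (fun k => X (reversal m k)) (fun k => Y (reversal m k)) (m + 1) ω =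
      eventTime X Y (m + 1) ω := by
  rw [eventTime_succ, eventTime_succ, eventTime_reversal, reversal_self]

lemma embeddedQueue_comp {Ω' : Type*} (f : Ω' → Ω) (i n : ℕ) (ω : Ω') :
    embeddedQueue (fun k => X k ∘ f) (fun k => Y k ∘ f) i n ω = embeddedQueue X Y i n (f ω) := by
  induction n with
  | zero => rfl
  | succ n ih => rw [embeddedQueue, embeddedQueue, ih, Function.comp_apply, Function.comp_apply]

variable [MeasurableSpace Ω]

lemma measurable_revQueue (hX : ∀ k, Measurable (X k)) (hY : ∀ k, Measurable (Y k)) (n i : ℕ) :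
    Measurable (revQueue X Y n i) := by
  induction n generalizing i with
  | zero => exact measurable_const
  | succ n ih =>
    have hsucc : revQueue X Y (n + 1) i = fun ω =>
        if X n ω < Y n ω then revQueue X Y n (i + 1) ω else revQueue X Y n (i - 1) ω := by
      funext ω
      rw [revQueue]
      split_ifs <;> rfl
    rw [hsucc]
    exact Measurable.ite (measurableSet_lt (hX n) (hY n)) (ih _) (ih _)

namespace IsIIDClocks

variable {P : Measure Ω} {p : ℝ} (h : IsIIDClocks P X Y p)
include h

lemma identDistrib_reindex {σ : ℕ → ℕ} (hσ : Function.Injective σ) :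
    IdentDistrib (fun ω k => (X (σ k) ω, Y (σ k) ω)) (fun ω k => (X k ω, Y k ω)) P P where
  aemeasurable_fst := (measurable_pi_iff.2 fun k => h.measurable_pair (σ k)).aemeasurable
  aemeasurable_snd := (measurable_pi_iff.2 h.measurable_pair).aemeasurable
  map_eq := by
    rw [(h.indep.precomp hσ).map_fun_eq_infinitePi_map fun k => h.measurable_pair (σ k),
      h.indep.map_fun_eq_infinitePi_map h.measurable_pair]
    congr 1
    funext k
    exact ((h.identDistrib (σ k)).trans (h.identDistrib k).symm).map_eq

lemma measure_embeddedQueue_eq_revQueue (i m j : ℕ) {B : Set (ℝ × ℝ)} (hB : MeasurableSet B) :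
    P {ω | embeddedQueue X Y i m ω = j ∧ (eventTime X Y m ω, eventTime X Y (m + 1) ω) ∈ B} =
      P {ω | revQueue X Y m i ω = j ∧ (eventTime X Y m ω, eventTime X Y (m + 1) ω) ∈ B} := by
  let U (k : ℕ) (z : ℕ → ℝ × ℝ) : ℝ := (z k).1
  let V (k : ℕ) (z : ℕ → ℝ × ℝ) : ℝ := (z k).2
  have hU (k : ℕ) : Measurable (U k) := measurable_fst.comp (measurable_pi_apply k)
  have hV (k : ℕ) : Measurable (V k) := measurable_snd.comp (measurable_pi_apply k)
  have hC : MeasurableSet {z | embeddedQueue U V i m z = j ∧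
      (eventTime U V m z, eventTime U V (m + 1) z) ∈ B} :=
    (measurable_embeddedQueue i m (fun k _ => hU k) (fun k _ => hV k)
      (measurableSet_singleton j)).inter
      ((measurable_eventTime hU hV m).prodMk (measurable_eventTime hU hV (m + 1)) hB)
  convert ((h.identDistrib_reindex (reversal_injective m)).measure_mem_eq hC).symm using 2
  · ext ω
    exact and_congr_left' (Eq.congr_left
      (embeddedQueue_comp (X := U) (Y := V) (fun ω k => (X k ω, Y k ω)) i m ω))
  · ext ω
    rw [Set.mem_ofPred_eq, ← embeddedQueue_eq_revQueue ω (X' := fun k => X (reversal m k))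
      (Y' := fun k => Y (reversal m k)) m i (fun k hk => by rw [reversal_of_lt hk])
      (fun k hk => by rw [reversal_of_lt hk]), ← eventTime_reversal, ← eventTime_reversal_succ]
    exact and_congr_left' (Eq.congr_left (embeddedQueue_comp (X := U) (Y := V)
      (fun ω k => (X (reversal m k) ω, Y (reversal m k) ω)) i m ω))

variable [IsProbabilityMeasure P]

lemma measure_apply_eventCount_eq_tsum {q : ℕ → Ω → ℕ} (hq : ∀ m, Measurable (q m)) (j : ℕ)
    {t : ℝ} (ht : 0 ≤ t) : P {ω | q (eventCount X Y t ω) ω = j} = ∑' m, P {ω | q m ω = j ∧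
      (eventTime X Y m ω, eventTime X Y (m + 1) ω) ∈ Set.Iic t ×ˢ Set.Ioi t} := by
  have hunion : {ω | q (eventCount X Y t ω) ω = j} =
      ⋃ m, {ω | q m ω = j} ∩ eventCount X Y t ⁻¹' {m} := by
    ext ω
    simp
  rw [hunion, measure_iUnion]
  · refine tsum_congr fun m => measure_congr ?_
    filter_upwards [h.pos, h.tendsto_eventTime] with ω hpos htend
    exact propext (and_congr_right' (eventCount_eq_iff (strictMono_eventTime hpos) htend ht))
  · exact fun m n hmn => ((Set.disjoint_singleton.2 hmn).preimage _).mono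
      Set.inter_subset_right Set.inter_subset_right
  · exact fun m => (hq m (measurableSet_singleton j)).inter
      (measurable_eventCount h.measurable_left h.measurable_right t (measurableSet_singleton m))

lemma measure_queueLength_eq_revQueue (i j : ℕ) {t : ℝ} (ht : 0 ≤ t) :
    P {ω | queueLength X Y i t ω = j} = P {ω | revQueue X Y (eventCount X Y t ω) i ω = j} := by
  unfold queueLength
  rw [h.measure_apply_eventCount_eq_tsum (q := embeddedQueue X Y i) (fun m =>
      measurable_embeddedQueue i m (fun k _ => h.measurable_left k) fun k _ => h.measurable_right k)
      j ht,
    h.measure_apply_eventCount_eq_tsum (q := fun m => revQueue X Y m i)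
      (fun m => measurable_revQueue h.measurable_left h.measurable_right m i) j ht]
  exact tsum_congr fun m =>
    h.measure_embeddedQueue_eq_revQueue i m j (measurableSet_Iic.prod measurableSet_Ioi)

lemma exists_limit_revQueue (hp : p < 1 / 2) : ∃ M : Ω → ℕ, Measurable M ∧
    ∀ᵐ ω ∂P, ∀ i, ∀ᶠ n in atTop, revQueue X Y n i ω = M ω := by
  have hconst : ∀ᵐ ω ∂P, ∃ c : ℕ, ∀ i, ∀ᶠ n in atTop, revQueue X Y n i ω = c := by
    filter_upwards [h.tendsto_walk_atBot hp] with ω hω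
    exact exists_eventually_revQueue_eq hω
  obtain ⟨M, hM, hMlim⟩ := measurable_limit_of_tendsto_metrizable_ae (L := atTop)
    (fun n => (measurable_revQueue h.measurable_left h.measurable_right n 0).aemeasurable) (by
      filter_upwards [hconst] with ω ⟨c, hc⟩
      exact ⟨c, tendsto_nhds_of_eventually_eq (hc 0)⟩)
  refine ⟨M, hM, ?_⟩
  filter_upwards [hconst, hMlim] with ω ⟨c, hc⟩ hω i
  rw [nhds_discrete, tendsto_pure] at hω
  obtain ⟨n, hnM, hnc⟩ := (hω.and (hc 0)).exists
  rw [← hnM, hnc]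
  exact hc i

variable {M : Ω → ℕ} (hM : Measurable M)
  (hlim : ∀ᵐ ω ∂P, ∀ i, ∀ᶠ n in atTop, revQueue X Y n i ω = M ω)
include hM hlim

lemma tendsto_measure_embeddedQueue (i j : ℕ) :
    Tendsto (fun n => P {ω | embeddedQueue X Y i n ω = j}) atTop (𝓝 (P {ω | M ω = j})) := by
  have hrev (n : ℕ) : P {ω | embeddedQueue X Y i n ω = j} = P {ω | revQueue X Y n i ω = j} := by
    simpa using h.measure_embeddedQueue_eq_revQueue i n j MeasurableSet.univ
  simp_rw [hrev]
  refine tendsto_measure_of_ae_tendsto_indicator_of_isFiniteMeasure atTop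
    (hM (measurableSet_singleton j)) (fun n =>
      measurable_revQueue h.measurable_left h.measurable_right n i (measurableSet_singleton j)) ?_
  filter_upwards [hlim] with ω hω
  filter_upwards [hω i] with n hn
  exact Eq.congr_left hn

lemma tendsto_measure_queueLength (i j : ℕ) :
    Tendsto (fun t : ℝ => P {ω | queueLength X Y i t ω = j}) atTop (𝓝 (P {ω | M ω = j})) := by
  have hmeas (t : ℝ) : Measurable fun ω => revQueue X Y (eventCount X Y t ω) i ω :=
    (measurable_from_prod_countable_right (f := fun q : ℕ × Ω => revQueue X Y q.1 i q.2) fun n =>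
      measurable_revQueue h.measurable_left h.measurable_right n i).comp
      ((measurable_eventCount h.measurable_left h.measurable_right t).prodMk measurable_id)
  refine (tendsto_measure_of_ae_tendsto_indicator_of_isFiniteMeasure atTop
    (hM (measurableSet_singleton j)) (fun t => hmeas t (measurableSet_singleton j)) ?_).congr' ?_
  · filter_upwards [hlim, h.tendsto_eventTime] with ω hω htend
    filter_upwards [(tendsto_eventCount htend).eventually (hω i)] with t ht
    exact Eq.congr_left ht
  · filter_upwards [eventually_ge_atTop 0] with t ht
    exact (h.measure_queueLength_eq_revQueue i j ht).symm

end IsIIDClocks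

end TimeReversal

section Equilibrium

/-- One step of the embedded queue, acting on the weights of its states: upwards with probability
`p`, downwards with probability `1 - p`, where the state `0` is kept instead. -/
def transition (p : ℝ) (q : ℕ → ℝ) : ℕ → ℝ
  | 0 => (1 - p) * (q 0 + q 1)
  | j + 1 => p * q j + (1 - p) * q (j + 2)

lemma continuous_transition (p : ℝ) : Continuous (transition p) :=
  continuous_pi fun j => by cases j <;> simp only [transition] <;> fun_prop

lemma hasSum_mul_transition_single (p : ℝ) (q : ℕ → ℝ) (j : ℕ) :
    HasSum (fun i => q i * transition p (Pi.single i 1) j) (transition p q j) := by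
  have hpoint (k : ℕ) : HasSum (fun i => q i * (Pi.single i 1 : ℕ → ℝ) k) (q k) := by
    simpa using hasSum_single (f := fun i => q i * (Pi.single i 1 : ℕ → ℝ) k) k
      fun i hi => by simp [hi.symm]
  cases j with
  | zero =>
    refine (((hpoint 0).add (hpoint 1)).mul_left (1 - p)).congr_fun fun i => ?_
    rw [transition]
    ring
  | succ j =>
    refine (((hpoint j).mul_left p).add ((hpoint (j + 2)).mul_left (1 - p))).congr_fun fun i => ?_
    rw [transition]
    ring

variable {p : ℝ} {q : ℕ → ℝ}

lemma eq_mul_pow_of_isFixedPt (hp : p < 1) (hq : Function.IsFixedPt (transition p) q) (j : ℕ) :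
    q j = q 0 * (p / (1 - p)) ^ j := by
  have hne : 1 - p ≠ 0 := by linarith
  have hdetailed (j : ℕ) : (1 - p) * q (j + 1) = p * q j := by
    have hj := congrFun hq j
    induction j with
    | zero =>
      rw [transition] at hj
      linarith
    | succ j ih =>
      rw [transition] at hj
      linarith [ih (congrFun hq j)]
  induction j with
  | zero => simp
  | succ j ih =>
    rw [pow_succ, ← mul_assoc, ← ih]
    field_simp
    linarith [hdetailed j]

lemma eq_equilibriumWeight_of_isFixedPt (hp0 : 0 ≤ p) (hp : p < 1 / 2)
    (hq : Function.IsFixedPt (transition p) q) (hsum : HasSum q 1) : q = equilibriumWeight p := by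
  have hpos : 0 < 1 - p := by linarith
  have hratio : p / (1 - p) < 1 := by
    rw [div_lt_one hpos]
    linarith
  have hgeom := (hasSum_geometric_of_lt_one (by positivity) hratio).mul_left (q 0)
  rw [← funext (eq_mul_pow_of_isFixedPt (by linarith) hq)] at hgeom
  have hzero : q 0 = 1 - p / (1 - p) := by
    have hone := hgeom.unique hsum
    rwa [← div_eq_mul_inv, div_eq_one_iff_eq (by linarith)] at hone
  funext j
  rw [eq_mul_pow_of_isFixedPt (by linarith) hq, equilibriumWeight, hzero]
  field_simp
  ring

lemma hasSum_toReal_pmf {α : Type*} (ν : PMF α) : HasSum (fun j => (ν j).toReal) 1 := by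
  have h := ENNReal.hasSum_toReal (f := ν) ν.tsum_coe_ne_top
  rwa [← ENNReal.tsum_toReal_eq ν.apply_ne_top, ν.tsum_coe, ENNReal.toReal_one] at h

namespace IsIIDClocks

variable {Ω : Type*} [MeasurableSpace Ω] {P : Measure Ω} {X Y : ℕ → Ω → ℝ}
  [IsProbabilityMeasure P] (h : IsIIDClocks P X Y p)
include h

lemma real_embeddedQueue_succ_eq_transition (i n j : ℕ) :
    P.real {ω | embeddedQueue X Y i (n + 1) ω = j} =
      transition p (fun k => P.real {ω | embeddedQueue X Y i n ω = k}) j := by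
  rw [h.real_embeddedQueue_succ]
  cases j with
  | zero =>
    have hpred : {ω | embeddedQueue X Y i n ω - 1 = 0} =
        {ω | embeddedQueue X Y i n ω = 0} ∪ {ω | embeddedQueue X Y i n ω = 1} := by
      ext ω
      simp only [Set.mem_ofPred_eq, Set.mem_union]
      omega
    have hdisj : Disjoint {ω | embeddedQueue X Y i n ω = 0} {ω | embeddedQueue X Y i n ω = 1} :=
      Set.disjoint_left.2 fun ω h0 h1 => zero_ne_one (h0.symm.trans h1)
    have hmeas : MeasurableSet {ω | embeddedQueue X Y i n ω = 1} :=
      measurable_embeddedQueue i n (fun k _ => h.measurable_left k)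
        (fun k _ => h.measurable_right k) (measurableSet_singleton 1)
    rw [transition, hpred, measureReal_union hdisj hmeas]
    simp [mul_comm]
  | succ j =>
    have hpred : {ω | embeddedQueue X Y i n ω - 1 = j + 1} =
        {ω | embeddedQueue X Y i n ω = j + 2} := by
      ext ω
      simp only [Set.mem_ofPred_eq]
      omega
    rw [transition, hpred]
    simp [mul_comm]

lemma isInvariant_iff (ν : PMF ℕ) : IsInvariant P (embeddedQueue X Y) ν ↔
    Function.IsFixedPt (transition p) fun j => (ν j).toReal := by
  refine Iff.trans (forall_congr' fun j => ?_) funext_iff.symm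
  have hfirst (i : ℕ) : P.real {ω | embeddedQueue X Y i 1 ω = j} =
      transition p (Pi.single i 1) j := by
    rw [h.real_embeddedQueue_succ_eq_transition]
    congr 1
    funext k
    by_cases hik : i = k <;> simp [embeddedQueue, hik, Ne.symm]
  have hterm (i : ℕ) : ν i * P {ω | embeddedQueue X Y i 1 ω = j} ≠ ∞ :=
    ENNReal.mul_ne_top (ν.apply_ne_top i) (measure_ne_top _ _)
  have htsum : ∑' i, ν i * P {ω | embeddedQueue X Y i 1 ω = j} ≠ ∞ :=
    ne_top_of_le_ne_top ν.tsum_coe_ne_top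
      (ENNReal.tsum_le_tsum fun i => mul_le_of_le_one_right' prob_le_one)
  rw [← ENNReal.toReal_eq_toReal_iff' htsum (ν.apply_ne_top j), ENNReal.tsum_toReal_eq hterm,
    ← (hasSum_mul_transition_single p (fun i => (ν i).toReal) j).tsum_eq]
  simp_rw [ENNReal.toReal_mul, ← measureReal_def, hfirst]

lemma isFixedPt_of_tendsto {i : ℕ}
    (hq : ∀ j, Tendsto (fun n => P.real {ω | embeddedQueue X Y i n ω = j}) atTop (𝓝 (q j))) :
    Function.IsFixedPt (transition p) q := by
  have hlim := tendsto_pi_nhds.2 hq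
  refine tendsto_nhds_unique (((continuous_transition p).tendsto q).comp hlim) ?_
  refine (hlim.comp (tendsto_add_atTop_nat 1)).congr fun n => ?_
  funext j
  exact h.real_embeddedQueue_succ_eq_transition i n j

lemma exists_equilibrium (hp : p < 1 / 2) :
    ∃ π : PMF ℕ, (∀ j, (π j).toReal = equilibriumWeight p j) ∧
      (∀ ν : PMF ℕ, IsInvariant P (embeddedQueue X Y) ν ↔ ν = π) ∧
      (∀ i j, Tendsto (fun n : ℕ => P.real {ω | embeddedQueue X Y i n ω = j})
        atTop (𝓝 (π j).toReal)) ∧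
      (∀ i j, Tendsto (fun t : ℝ => P.real {ω | queueLength X Y i t ω = j})
        atTop (𝓝 (π j).toReal)) := by
  obtain ⟨M, hM, hlim⟩ := h.exists_limit_revQueue hp
  have := Measure.isProbabilityMeasure_map (μ := P) hM.aemeasurable
  let π : PMF ℕ := (P.map M).toPMF
  have hπ (j : ℕ) : π j = P {ω | M ω = j} := by
    rw [Measure.toPMF_apply, Measure.map_apply hM (measurableSet_singleton j)]
    rfl
  have hembedded (i j : ℕ) : Tendsto (fun n => P.real {ω | embeddedQueue X Y i n ω = j}) atTop
      (𝓝 (π j).toReal) := by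
    rw [hπ]
    exact (ENNReal.tendsto_toReal (measure_ne_top _ _)).comp
      (h.tendsto_measure_embeddedQueue hM hlim i j)
  have hlength (i j : ℕ) : Tendsto (fun t => P.real {ω | queueLength X Y i t ω = j}) atTop
      (𝓝 (π j).toReal) := by
    rw [hπ]
    exact (ENNReal.tendsto_toReal (measure_ne_top _ _)).comp
      (h.tendsto_measure_queueLength hM hlim i j)
  have hfixed := h.isFixedPt_of_tendsto (hembedded 0)
  have hp0 : 0 ≤ p := h.prob_zero ▸ measureReal_nonneg
  have hweight := eq_equilibriumWeight_of_isFixedPt hp0 hp hfixed (hasSum_toReal_pmf π)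
  refine ⟨π, congrFun hweight, fun ν => ?_, hembedded, hlength⟩
  rw [h.isInvariant_iff]
  refine ⟨fun hν => PMF.ext fun j => ?_, fun hν => hν ▸ hfixed⟩
  rw [← ENNReal.toReal_eq_toReal_iff' (ν.apply_ne_top j) (π.apply_ne_top j)]
  exact congrFun ((eq_equilibriumWeight_of_isFixedPt hp0 hp hν (hasSum_toReal_pmf ν)).trans
    hweight.symm) j

end IsIIDClocks

end Equilibrium

section CriticalCase

section Excursion

variable {Ω : Type*} (X Y : ℕ → Ω → ℝ) (ω : Ω)

lemma step_eq_one_or_neg_one (n : ℕ) : step X Y n ω = 1 ∨ step X Y n ω = -1 := ite_eq_or_eq _ _ _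

/-- The height above the initial state of the first excursion of the queue, if the first event is
an arrival, and `0` otherwise: `excursion X Y n` is the height after `n + 1` events, and the
excursion is stopped when it returns to `0`. -/
noncomputable def excursion (X Y : ℕ → Ω → ℝ) : ℕ → Ω → ℤ
  | 0, ω => if X 0 ω < Y 0 ω then 1 else 0
  | n + 1, ω => excursion X Y n ω + if 0 < excursion X Y n ω then step X Y (n + 1) ω else 0

lemma excursion_nonneg (n : ℕ) : 0 ≤ excursion X Y n ω := by
  induction n with
  | zero => rw [excursion]; split_ifs <;> simp
  | succ n ih =>
    have := step_eq_one_or_neg_one X Y ω (n + 1)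
    rw [excursion]
    split_ifs <;> omega

lemma excursion_le (n : ℕ) : excursion X Y n ω ≤ n + 1 := by
  induction n with
  | zero => rw [excursion]; split_ifs <;> simp
  | succ n ih =>
    have := step_eq_one_or_neg_one X Y ω (n + 1)
    rw [excursion]
    split_ifs <;> push_cast <;> omega

variable {X Y ω}

lemma excursion_eq_zero_of_le {m n : ℕ} (hmn : m ≤ n) (h : excursion X Y m ω = 0) :
    excursion X Y n ω = 0 := by
  induction n, hmn using Nat.le_induction with
  | base => exact h
  | succ n _ ih => rw [excursion, ih]; simp

lemma embeddedQueue_eq_add_excursion (i n : ℕ) (h : 0 < excursion X Y n ω) :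
    (embeddedQueue X Y i (n + 1) ω : ℤ) = i + excursion X Y n ω := by
  induction n with
  | zero =>
    rw [excursion] at h ⊢
    split_ifs at h ⊢ with harrival
    · simp [embeddedQueue, harrival]
    · exact absurd h (lt_irrefl 0)
  | succ n ih =>
    have hpos : 0 < excursion X Y n ω := (excursion_nonneg X Y ω n).lt_of_ne fun hzero =>
      h.ne' (excursion_eq_zero_of_le n.le_succ hzero.symm)
    rw [natCast_embeddedQueue_succ, ih hpos, excursion, if_pos hpos]
    rw [excursion, if_pos hpos] at h
    omega

lemma excursion_eq_zero_of_return {i m n : ℕ} (hm : 1 ≤ m) (hmn : m ≤ n + 1)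
    (h : embeddedQueue X Y i m ω = i) : excursion X Y n ω = 0 := by
  refine excursion_eq_zero_of_le (m := m - 1) (by omega) ?_
  by_contra hne
  have hheight := embeddedQueue_eq_add_excursion i (m - 1)
    ((excursion_nonneg X Y ω _).lt_of_ne (Ne.symm hne))
  rw [Nat.sub_add_cancel hm, h] at hheight
  omega

variable (X Y ω) in
lemma ofReal_excursion_le_returnTime (i n : ℕ) :
    ENNReal.ofReal (excursion X Y n ω) ≤ returnTime (embeddedQueue X Y) i ω := by
  refine le_iInf₂ fun m hm => ?_
  rcases le_or_gt m (n + 1) with hmn | hmn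
  · simp [excursion_eq_zero_of_return hm.1 hmn hm.2]
  · rw [← ENNReal.ofReal_natCast]
    refine ENNReal.ofReal_le_ofReal ?_
    have hle := excursion_le X Y ω n
    exact_mod_cast hle.trans (by omega : (n : ℤ) + 1 ≤ m)

end Excursion

variable {Ω : Type*} {X Y : ℕ → Ω → ℝ}

lemma measurable_step_past {n k : ℕ} (hk : k < n) : Measurable[past X Y n] (step X Y k) :=
  .ite (measurable_pair_past hk (measurableSet_lt measurable_fst measurable_snd))
    measurable_const measurable_const

lemma measurable_walk_past (n : ℕ) : Measurable[past X Y n] (walk X Y n) :=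
  Finset.measurable_fun_sum _ fun _ hk => measurable_step_past (Finset.mem_range.1 hk)

lemma measurable_excursion_past (n : ℕ) : Measurable[past X Y (n + 1)] (excursion X Y n) := by
  induction n with
  | zero => exact .ite (measurable_pair_past Nat.zero_lt_one
      (measurableSet_lt measurable_fst measurable_snd)) measurable_const measurable_const
  | succ n ih =>
    have hpast : Measurable[past X Y (n + 1 + 1)] (excursion X Y n) :=
      ih.mono (past_mono (n + 1).le_succ) le_rfl
    exact hpast.add (.ite (hpast measurableSet_Ioi)
      (measurable_step_past (n + 1).lt_succ_self) measurable_const)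

lemma not_tendsto_walk_nhds (ω : Ω) (c : ℝ) :
    ¬ Tendsto (fun n => (walk X Y n ω : ℝ)) atTop (𝓝 c) := by
  intro hc
  have hstep := ((hc.comp (tendsto_add_atTop_nat 1)).sub hc).abs
  rw [sub_self, abs_zero] at hstep
  refine one_ne_zero (tendsto_nhds_unique (tendsto_const_nhds (x := (1 : ℝ)))
    (hstep.congr fun n => ?_))
  rcases step_eq_one_or_neg_one X Y ω n with h | h <;> simp [walk_succ, h]

namespace IsIIDClocks

variable [MeasurableSpace Ω] {P : Measure Ω} {p : ℝ} (h : IsIIDClocks P X Y p)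
include h

lemma measurable_excursion (n : ℕ) : Measurable (excursion X Y n) :=
  (measurable_excursion_past n).mono (h.past_le _) le_rfl

lemma integral_excursion_zero : ∫ ω, (excursion X Y 0 ω : ℝ) ∂P = p := by
  have hindicator : (fun ω => (excursion X Y 0 ω : ℝ)) = {ω | X 0 ω < Y 0 ω}.indicator 1 := by
    funext ω
    by_cases hω : X 0 ω < Y 0 ω <;> simp [excursion, hω]
  rw [hindicator, integral_indicator_one (h.measurableSet_lt 0), h.prob]

variable [IsProbabilityMeasure P]

lemma integrable_step (n : ℕ) : Integrable (fun ω => (step X Y n ω : ℝ)) P := by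
  have hmeas : Measurable (step X Y n) :=
    (measurable_step_past n.lt_succ_self).mono (h.past_le _) le_rfl
  refine .of_bound ((measurable_from_top (f := Int.cast)).comp hmeas).aestronglyMeasurable 1
    (ae_of_all _ fun ω => ?_)
  rcases step_eq_one_or_neg_one X Y ω n with hstep | hstep <;> simp [hstep]

lemma martingale_walk (hp : p = 1 / 2) :
    Martingale (fun n ω => (walk X Y n ω : ℝ)) ⟨past X Y, past_mono, h.past_le⟩ P := by
  refine martingale_of_condExp_sub_eq_zero_nat (fun n => ?_) (fun n => ?_) fun n => ?_
  · exact ((measurable_from_top (f := Int.cast)).comp (measurable_walk_past n)).stronglyMeasurable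
  · simp only [walk, Int.cast_sum]
    exact integrable_finsetSum _ fun k _ => h.integrable_step k
  · have hincrement : ((fun ω => (walk X Y (n + 1) ω : ℝ)) - fun ω => (walk X Y n ω : ℝ)) =
        fun ω => (step X Y n ω : ℝ) := by
      funext ω
      simp [walk_succ]
    have hmeas : Measurable[MeasurableSpace.comap (fun ω => (X n ω, Y n ω)) inferInstance]
        (step X Y n) :=
      .ite (measurableSet_lt_comap n) measurable_const measurable_const
    rw [hincrement]
    refine (condExp_indep_eq (h.measurable_pair n).comap_le (h.past_le n)
      ((measurable_from_top (f := Int.cast)).comp hmeas).stronglyMeasurable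
      (h.indep_past n).symm).trans (ae_of_all _ fun _ => ?_)
    simp only [Function.comp_apply]
    rw [h.integral_step, hp]
    norm_num

lemma ae_not_bdd_walk (hp : p = 1 / 2) : ∀ᵐ ω ∂P,
    ¬ BddBelow (Set.range (walk X Y · ω)) ∧ ¬ BddAbove (Set.range (walk X Y · ω)) := by
  have hmart := h.martingale_walk hp
  have hbdd : ∀ᵐ ω ∂P, ∀ n, |(walk X Y (n + 1) ω : ℝ) - walk X Y n ω| ≤ (1 : NNReal) :=
    ae_of_all _ fun ω n => by
      rcases step_eq_one_or_neg_one X Y ω n with hstep | hstep <;> simp [walk_succ, hstep]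
  filter_upwards [hmart.submartingale.bddAbove_iff_exists_tendsto hbdd,
    hmart.bddAbove_range_iff_bddBelow_range hbdd] with ω hconv hsymm
  have habove : ¬ BddAbove (Set.range fun n => (walk X Y n ω : ℝ)) := fun hb =>
    (hconv.1 hb).elim (not_tendsto_walk_nhds ω)
  have hcast : (Set.range fun n => (walk X Y n ω : ℝ)) = Int.cast '' Set.range (walk X Y · ω) :=
    Set.range_comp Int.cast (walk X Y · ω)
  rw [hcast] at habove hsymm
  exact ⟨fun hb => habove (hsymm.2 (Int.cast_mono.map_bddBelow hb)),
    fun hb => habove (Int.cast_mono.map_bddAbove hb)⟩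

lemma isRecurrent (hp : p = 1 / 2) : IsRecurrent P (embeddedQueue X Y) := by
  intro i
  filter_upwards [h.ae_not_bdd_walk hp] with ω hω
  exact frequently_embeddedQueue_eq i i hω.1 hω.2

lemma integrable_excursion (n : ℕ) : Integrable (fun ω => (excursion X Y n ω : ℝ)) P := by
  refine .of_bound ((measurable_from_top (f := Int.cast)).comp
    (h.measurable_excursion n)).aestronglyMeasurable (n + 1) (ae_of_all _ fun ω => ?_)
  rw [Real.norm_of_nonneg (mod_cast excursion_nonneg X Y ω n)]
  exact_mod_cast excursion_le X Y ω n

lemma integral_excursion_succ (n : ℕ) : ∫ ω, (excursion X Y (n + 1) ω : ℝ) ∂P =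
    ∫ ω, (excursion X Y n ω : ℝ) ∂P + P.real {ω | 0 < excursion X Y n ω} * (2 * p - 1) := by
  set alive : Set Ω := {ω | 0 < excursion X Y n ω} with halive
  set arrival : Set Ω := {ω | X (n + 1) ω < Y (n + 1) ω} with harrival
  have hpast : MeasurableSet[past X Y (n + 1)] alive :=
    measurable_excursion_past n measurableSet_Ioi
  have hmeas : MeasurableSet alive := h.past_le _ _ hpast
  have hup : MeasurableSet (alive ∩ arrival) := hmeas.inter (h.measurableSet_lt (n + 1))
  have hdown : MeasurableSet (alive \ arrival) := hmeas.diff (h.measurableSet_lt (n + 1))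
  have hintup : Integrable ((alive ∩ arrival).indicator (1 : Ω → ℝ)) P :=
    (integrable_const 1).indicator hup
  have hintdown : Integrable ((alive \ arrival).indicator (1 : Ω → ℝ)) P :=
    (integrable_const 1).indicator hdown
  have hsucc : (fun ω => (excursion X Y (n + 1) ω : ℝ)) = fun ω => (excursion X Y n ω : ℝ) +
      ((alive ∩ arrival).indicator (1 : Ω → ℝ) - (alive \ arrival).indicator (1 : Ω → ℝ)) ω := by
    funext ω
    by_cases hpos : 0 < excursion X Y n ω <;> by_cases hω : X (n + 1) ω < Y (n + 1) ω <;>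
      simp [excursion, step, halive, harrival, hpos, hω]
  rw [hsucc, integral_add (h.integrable_excursion n) (hintup.sub hintdown),
    integral_sub' hintup hintdown, integral_indicator_one hup, integral_indicator_one hdown,
    h.real_inter_lt hpast, h.real_sdiff_lt hpast]
  ring

lemma integral_excursion (hp : p = 1 / 2) (n : ℕ) :
    ∫ ω, (excursion X Y n ω : ℝ) ∂P = 1 / 2 := by
  induction n with
  | zero => rw [h.integral_excursion_zero, hp]
  | succ n ih => rw [h.integral_excursion_succ, ih, hp]; norm_num

lemma isNullRecurrent (hp : p = 1 / 2) : IsNullRecurrent P (embeddedQueue X Y) := by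
  refine ⟨h.isRecurrent hp, fun i => ?_⟩
  -- The excursion tends to `0` and is bounded by the return time, so if the latter were integrable,
  -- then the constant mean of the excursion would have to tend to `0`.
  by_contra hfin
  have hzero : ∀ᵐ ω ∂P,
      Tendsto (fun n => ENNReal.ofReal (excursion X Y n ω)) atTop (𝓝 0) := by
    filter_upwards [h.isRecurrent hp i] with ω hω
    obtain ⟨m, hm, hmi⟩ := frequently_atTop.1 hω 1
    refine tendsto_nhds_of_eventually_eq ?_
    filter_upwards [eventually_ge_atTop m] with n hn
    simp [excursion_eq_zero_of_return hm (hn.trans n.le_succ) hmi]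
  have hlim := tendsto_lintegral_of_dominated_convergence (returnTime (embeddedQueue X Y) i)
    (fun n => (measurable_from_top (f := fun k : ℤ => ENNReal.ofReal k)).comp
      (h.measurable_excursion n))
    (fun n => ae_of_all _ fun ω => ofReal_excursion_le_returnTime X Y ω i n) hfin hzero
  have hmean (n : ℕ) : ∫⁻ ω, ENNReal.ofReal (excursion X Y n ω) ∂P = ENNReal.ofReal (1 / 2) := by
    rw [← ofReal_integral_eq_lintegral_ofReal (h.integrable_excursion n)
      (ae_of_all _ fun ω => Int.cast_nonneg (excursion_nonneg X Y ω n)), h.integral_excursion hp]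
  simp only [Function.comp_apply, hmean, lintegral_zero] at hlim
  have hhalf := tendsto_nhds_unique tendsto_const_nhds hlim
  norm_num at hhalf

lemma not_isTransient (hp : p ≤ 1 / 2) : ¬ IsTransient P (embeddedQueue X Y) := by
  intro htransient
  have hunbounded : ∀ᵐ ω ∂P, ¬ BddBelow (Set.range (walk X Y · ω)) := by
    rcases hp.lt_or_eq with hlt | heq
    · filter_upwards [h.tendsto_walk_atBot hlt] with ω hω
      rintro ⟨c, hc⟩
      obtain ⟨n, hn⟩ := (hω.eventually_lt_atBot c).exists
      exact hn.not_ge (hc ⟨n, rfl⟩)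
    · exact (h.ae_not_bdd_walk heq).mono fun _ hω => hω.1
  obtain ⟨ω, hω, hfinite⟩ :=
    (hunbounded.and (measure_eq_zero_iff_ae_notMem.1 (htransient 0))).exists
  exact hfinite (frequently_embeddedQueue_eq_zero 0 hω)

end IsIIDClocks

end CriticalCase

end RenewalQueue

theorem mainTheorem3_general (a b : ℝ) (ha : a ∈ Set.Ioc (0 : ℝ) 1)
    (hb : b ∈ Set.Ioc (0 : ℝ) 1) :
    ∃ ρ : ℝ, 0 < ρ ∧
      ∀ (lam mu : ℝ), 0 < lam → 0 < mu →
      ∀ (Ω : Type*) [MeasurableSpace Ω] (P : Measure Ω) [IsProbabilityMeasure P]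
        (X Y : ℕ → Ω → ℝ), IsMittagLefflerClocks P a b lam mu X Y →
        (IsTransient P (embeddedQueue X Y) ↔ ρ < lam / mu) ∧
        (lam / mu < ρ →
          ∃ π : PMF ℕ,
            (∀ j, (π j).toReal = equilibriumWeight (P.real {ω | X 0 ω < Y 0 ω}) j) ∧
            (∀ ν : PMF ℕ, IsInvariant P (embeddedQueue X Y) ν ↔ ν = π) ∧
            (∀ i j, Tendsto (fun n : ℕ => P.real {ω | embeddedQueue X Y i n ω = j})
              atTop (𝓝 (π j).toReal)) ∧
            (∀ i j, Tendsto (fun t : ℝ => P.real {ω | queueLength X Y i t ω = j})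
              atTop (𝓝 (π j).toReal))) ∧
        (lam / mu = ρ → IsNullRecurrent P (embeddedQueue X Y)) := by
  obtain ⟨ρ, hρ, hcritical⟩ := exists_criticalRatio ha hb
  refine ⟨ρ, hρ, fun lam mu hlam hmu Ω _ P _ X Y h => ?_⟩
  obtain ⟨hlt, heq⟩ := hcritical lam mu hlam hmu Ω P X Y h
  have hclocks := h.isIIDClocks ha.1.ne' hb.1.ne' hlam hmu
  have hle : P.real {ω | X 0 ω < Y 0 ω} ≤ 1 / 2 ↔ lam / mu ≤ ρ := by
    rw [le_iff_lt_or_eq, le_iff_lt_or_eq, hlt, heq]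
  refine ⟨⟨fun htransient => ?_, fun hgt => ?_⟩,
    fun hsub => hclocks.exists_equilibrium (hlt.2 hsub),
    fun hcrit => hclocks.isNullRecurrent (heq.2 hcrit)⟩
  · exact not_le.1 fun hsub => hclocks.not_isTransient (hle.2 hsub) htransient
  · exact hclocks.isTransient (not_le.1 fun hhalf => hgt.not_ge (hle.1 hhalf))

theorem mainTheorem3 (a b : ℝ) (ha : a ∈ Set.Ioo (0 : ℝ) 1) (hb : b ∈ Set.Ioo (0 : ℝ) 1) :
    ∃ ρ : ℝ, 0 < ρ ∧
      ∀ (lam mu : ℝ), 0 < lam → 0 < mu →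
      ∀ (Ω : Type*) [MeasurableSpace Ω] (P : Measure Ω) [IsProbabilityMeasure P]
        (X Y : ℕ → Ω → ℝ), IsMittagLefflerClocks P a b lam mu X Y →
        (IsTransient P (embeddedQueue X Y) ↔ ρ < lam / mu) ∧
        (lam / mu < ρ →
          ∃ π : PMF ℕ,
            (∀ j, (π j).toReal = equilibriumWeight (P.real {ω | X 0 ω < Y 0 ω}) j) ∧
            (∀ ν : PMF ℕ, IsInvariant P (embeddedQueue X Y) ν ↔ ν = π) ∧
            (∀ i j, Tendsto (fun n : ℕ => P.real {ω | embeddedQueue X Y i n ω = j})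
              atTop (𝓝 (π j).toReal)) ∧
            (∀ i j, Tendsto (fun t : ℝ => P.real {ω | queueLength X Y i t ω = j})
              atTop (𝓝 (π j).toReal))) ∧
        (lam / mu = ρ → IsNullRecurrent P (embeddedQueue X Y)) :=
  mainTheorem3_general a b ⟨ha.1, ha.2.le⟩ ⟨hb.1, hb.2.le⟩
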